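/- Let $\Gamma=(\mathcal V,\mathcal E)$ be a finite simple graph which is chordal (every cycle with more than three vertices has a chord), and fix any total order on $\mathcal V$. For an edge $e$ write $h(e)$ for its larger and $t(e)$ for its smaller vertex, and order $\mathcal E$ by $e<e'$ if $h(e)<h(e')$, or $h(e)=h(e')$ and $t(e)<t(e')$. Let $E$ be a complex elliptic curve, and let $\mathcal A=\mathcal A(\Gamma,E)=\{H_e\mid e\in\mathcal E\}$, $H_e=\{x\in E^{\mathcal V}\mid x_{h(e)}=x_{t(e)}\}$, be the corresponding chordal abelian arrangement. Let $A(\mathcal A)$ be the underlying graded algebra of its model, which depends only on $\Gamma$: the quotient of the exterior algebra on the $\mathbb Q$-vector space with basis $\{x_v,y_v,g_e\mid v\in\mathcal V,\ e\in\mathcal E\}$ by the two-sided ideal generated by (i) $\sum_{j=1}^k(-1)^j g_{e_1}\cdots\widehat{g_{e_j}}\cdots g_{e_k}$ whenever $e_1<\dots<e_k$ are the edges of a cycle of $\Gamma$, and (ii) $(x_{h(e)}-x_{t(e)})g_e$ and $(y_{h(e)}-y_{t(e)})g_e$ for each $e\in\mathcal E$, graded so that every generator $x_v,y_v,g_e$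 has degree $1$. Then $A=A(\mathcal A)$ is a Koszul algebra: $A^0=\mathbb Q$, and the trivial left module $\mathbb Q=A/A^{+}$ has a graded free resolution $$\cdots\to F_2\to F_1\to F_0\to\mathbb Q\to 0$$ over $A$ in which each $F_n$ is free on generators of degree $n$ (equivalently, the resolution is linear). -/

import Mathlib

/-! ## Koszul algebras -/

/-- A graded `k`-algebra `A = ⨁ₙ 𝒜 n` is *Koszul* if it is connected (`𝒜 0 = k`) and the trivial
left `A`-module `k = A / A₊` has a linear free resolution
`⋯ → A(-2)^(ι 2) → A(-1)^(ι 1) → A^(ι 0) → k → 0`: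
the `n`-th term is the free graded module on generators `ι n` placed in internal degree `n`, so that
the differentials, being homogeneous of degree `0`, are `A`-linear maps whose matrix entries lie in
`𝒜 1`. (The augmentation `ε` is automatically homogeneous, `A / A₊` being concentrated in
degree `0`.) -/
def IsKoszul.{u, v} {k : Type u} {A : Type v} [Field k] [Ring A] [Algebra k A]
    (𝒜 : ℕ → Submodule k A) [GradedAlgebra 𝒜] : Prop :=
  Nontrivial A ∧ 𝒜 0 = 1 ∧
  ∃ (ι : ℕ → Type v)
    (ε : (ι 0 →₀ A) →ₗ[A] (A ⧸ (HomogeneousIdeal.irrelevant 𝒜).toIdeal))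
    (d : ∀ n, (ι (n + 1) →₀ A) →ₗ[A] (ι n →₀ A)),
    (∀ n i j, d n (Finsupp.single i 1) j ∈ 𝒜 1) ∧
    Function.Surjective ε ∧
    Function.Exact (d 0) ε ∧
    ∀ n, Function.Exact (d (n + 1)) (d n)

namespace SimpleGraph

/-! ## Chordal graphs and ordered graphs -/

/-- A simple graph is *chordal* if every cycle with more than three vertices has a chord. -/
def IsChordal {V : Type*} (Γ : SimpleGraph V) : Prop :=
  ∀ (v : V) (c : Γ.Walk v v), c.IsCycle → 3 < c.length → ∃ e, c.IsChord e

section Model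

variable {V : Type*} [LinearOrder V] (Γ : SimpleGraph V)

/-- The head `h(e)` of an edge: its larger vertex. -/
def head (e : Γ.edgeSet) : V := (e : Sym2 V).sup

/-- The tail `t(e)` of an edge: its smaller vertex. -/
def tail (e : Γ.edgeSet) : V := (e : Sym2 V).inf

/-- A list of edges is an *ordered cycle* `e₁ < ⋯ < eₖ` if it is strictly increasing for the order
on edges (`e < e'` iff `h(e) < h(e')`, or `h(e) = h(e')` and `t(e) < t(e')`), and its members are
precisely the edges of some cycle of the graph. -/
def IsOrderedCycle (l : List Γ.edgeSet) : Prop :=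
  l.Pairwise (fun e e' => toLex (Γ.head e, Γ.tail e) < toLex (Γ.head e', Γ.tail e')) ∧
  ∃ (v : V) (c : Γ.Walk v v), c.IsCycle ∧ ∀ e : Γ.edgeSet, e ∈ l ↔ (e : Sym2 V) ∈ c.edges

/-! ## The algebra `A(𝒜)` of the graphic abelian arrangement -/

/-- Index type of the generators `x_v`, `y_v` (for vertices `v`) and `g_e` (for edges `e`). -/
inductive ModelGen
  | x (v : V)
  | y (v : V)
  | g (e : Γ.edgeSet)

/-- The exterior algebra on the `ℚ`-vector space with basis `x_v`, `y_v`, `g_e`. -/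
abbrev ModelExterior := ExteriorAlgebra ℚ (ModelGen Γ →₀ ℚ)

/-- A generator, as an element of the exterior algebra. -/
noncomputable def modelGen (a : ModelGen Γ) : ModelExterior Γ :=
  ExteriorAlgebra.ι ℚ (Finsupp.single a 1)

/-- `∂ g_C = ∑ⱼ (-1)ʲ g_{e₁} ⋯ ĝ_{eⱼ} ⋯ g_{eₖ}` for the list `C = [e₁, …, eₖ]`
(the summation index here starts at `0`, whence the exponent `j + 1`). -/
noncomputable def boundary (l : List Γ.edgeSet) : ModelExterior Γ :=
  ∑ j ∈ Finset.range l.length,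
    (-1) ^ (j + 1) * ((l.eraseIdx j).map fun e => modelGen Γ (.g e)).prod

/-- The defining relations: Orlik–Solomon relations for the cycles of the graph, and
`(x_{h(e)} - x_{t(e)}) g_e`, `(y_{h(e)} - y_{t(e)}) g_e` for its edges. -/
inductive ModelRel : ModelExterior Γ → ModelExterior Γ → Prop
  | cycle (l : List Γ.edgeSet) (hl : IsOrderedCycle Γ l) : ModelRel (boundary Γ l) 0
  | x (e : Γ.edgeSet) :
      ModelRel ((modelGen Γ (.x (Γ.head e)) - modelGen Γ (.x (Γ.tail e))) * modelGen Γ (.g e)) 0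
  | y (e : Γ.edgeSet) :
      ModelRel ((modelGen Γ (.y (Γ.head e)) - modelGen Γ (.y (Γ.tail e))) * modelGen Γ (.g e)) 0

/-- The underlying algebra of the model `A(𝒜)`, `𝒜 = 𝒜(Γ, E)`: the quotient of the exterior algebra
by the two-sided ideal generated by the relations. It depends on the ordered graph `Γ` only. -/
abbrev AbelianModel := RingQuot (ModelRel Γ)

/-- The quotient map from the exterior algebra. -/
noncomputable abbrev AbelianModel.mk : ModelExterior Γ →ₐ[ℚ] AbelianModel Γ :=
  RingQuot.mkAlgHom ℚ (ModelRel Γ)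

/-- The grading of the model in which all the generators `x_v`, `y_v`, `g_e` have degree one:
the `n`-th piece is the image of the `n`-th exterior power. -/
noncomputable def AbelianModel.grading (n : ℕ) : Submodule ℚ (AbelianModel Γ) :=
  (⋀[ℚ]^n (ModelGen Γ →₀ ℚ)).map (AbelianModel.mk Γ).toLinearMap

/-! The grading is well defined because the relations are homogeneous. -/

theorem ι_mem_one {V : Type*} (Γ : SimpleGraph V) (m : ModelGen Γ →₀ ℚ) :
    ExteriorAlgebra.ι ℚ m ∈ ⋀[ℚ]^1 (ModelGen Γ →₀ ℚ) := by
  simpa only [pow_one] using LinearMap.mem_range_self (ExteriorAlgebra.ι ℚ) m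

theorem modelGen_mem (a : ModelGen Γ) : modelGen Γ a ∈ ⋀[ℚ]^1 (ModelGen Γ →₀ ℚ) :=
  ι_mem_one Γ _

theorem modelGen_prod_mem (l : List Γ.edgeSet) :
    (l.map fun e => modelGen Γ (.g e)).prod ∈ ⋀[ℚ]^l.length (ModelGen Γ →₀ ℚ) := by
  induction l with
  | nil => simp
  | cons e l ih =>
    rw [List.map_cons, List.prod_cons, List.length_cons, add_comm]
    exact SetLike.GradedMul.mul_mem (A := fun i : ℕ => ⋀[ℚ]^i (ModelGen Γ →₀ ℚ))
      (modelGen_mem Γ _) ih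

theorem boundary_mem (l : List Γ.edgeSet) :
    boundary Γ l ∈ ⋀[ℚ]^(l.length - 1) (ModelGen Γ →₀ ℚ) := by
  refine Submodule.sum_mem _ fun j hj => ?_
  have h := modelGen_prod_mem Γ (l.eraseIdx j)
  rw [List.length_eraseIdx_of_lt (Finset.mem_range.1 hj)] at h
  rcases neg_one_pow_eq_or (ModelExterior Γ) (j + 1) with h1 | h1
  · rwa [h1, one_mul]
  · rw [h1, neg_one_mul]; exact Submodule.neg_mem _ h

theorem ModelRel.homogeneous {a b : ModelExterior Γ} (h : ModelRel Γ a b) :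
    b = 0 ∧ ∃ n : ℕ, a ∈ ⋀[ℚ]^n (ModelGen Γ →₀ ℚ) := by
  cases h with
  | cycle l hl => exact ⟨rfl, _, boundary_mem Γ l⟩
  | x e =>
    exact ⟨rfl, 1 + 1, SetLike.GradedMul.mul_mem (A := fun i : ℕ => ⋀[ℚ]^i (ModelGen Γ →₀ ℚ))
      (Submodule.sub_mem _ (modelGen_mem Γ _) (modelGen_mem Γ _)) (modelGen_mem Γ _)⟩
  | y e =>
    exact ⟨rfl, 1 + 1, SetLike.GradedMul.mul_mem (A := fun i : ℕ => ⋀[ℚ]^i (ModelGen Γ →₀ ℚ))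
      (Submodule.sub_mem _ (modelGen_mem Γ _) (modelGen_mem Γ _)) (modelGen_mem Γ _)⟩

instance AbelianModel.gradedMonoid : SetLike.GradedMonoid (AbelianModel.grading Γ) where
  one_mem := ⟨1, SetLike.GradedOne.one_mem (A := fun i : ℕ => ⋀[ℚ]^i (ModelGen Γ →₀ ℚ)),
    map_one (AbelianModel.mk Γ)⟩
  mul_mem := by
    rintro i j _ _ ⟨a, ha, rfl⟩ ⟨b, hb, rfl⟩
    exact ⟨a * b, SetLike.GradedMul.mul_mem (A := fun i : ℕ => ⋀[ℚ]^i (ModelGen Γ →₀ ℚ)) ha hb,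
      map_mul (AbelianModel.mk Γ) a b⟩

open scoped DirectSum in
/-- Auxiliary: the degree-one inclusion of the generators into the direct sum of the pieces. -/
noncomputable def AbelianModel.decomposeι :
    (ModelGen Γ →₀ ℚ) →ₗ[ℚ] ⨁ i, AbelianModel.grading Γ i :=
  DirectSum.lof ℚ ℕ (fun i => AbelianModel.grading Γ i) 1 ∘ₗ
    ((AbelianModel.mk Γ).toLinearMap ∘ₗ ExteriorAlgebra.ι ℚ).codRestrict _ fun m =>
      ⟨ExteriorAlgebra.ι ℚ m, ι_mem_one Γ m, rfl⟩

theorem AbelianModel.decomposeι_apply (m : ModelGen Γ →₀ ℚ) :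
    decomposeι Γ m = DirectSum.of (fun i => AbelianModel.grading Γ i) 1
      ⟨AbelianModel.mk Γ (ExteriorAlgebra.ι ℚ m),
        ⟨ExteriorAlgebra.ι ℚ m, ι_mem_one Γ m, rfl⟩⟩ :=
  rfl

open scoped DirectSum in
/-- Auxiliary: the decomposition map on the exterior algebra. -/
noncomputable def AbelianModel.decomposeExt :
    ModelExterior Γ →ₐ[ℚ] ⨁ i, AbelianModel.grading Γ i :=
  ExteriorAlgebra.lift ℚ ⟨decomposeι Γ, fun m => by
    rw [decomposeι_apply, DirectSum.of_mul_of]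
    refine DFinsupp.single_eq_zero.mpr (Subtype.ext ?_)
    change AbelianModel.mk Γ (ExteriorAlgebra.ι ℚ m) * AbelianModel.mk Γ (ExteriorAlgebra.ι ℚ m) = 0
    rw [← map_mul, ExteriorAlgebra.ι_sq_zero, map_zero]⟩

theorem AbelianModel.decomposeExt_eq (i : ℕ) (a : ModelExterior Γ)
    (ha : a ∈ ⋀[ℚ]^i (ModelGen Γ →₀ ℚ)) :
    decomposeExt Γ a = DirectSum.of (fun i => AbelianModel.grading Γ i) i
      ⟨AbelianModel.mk Γ a, ⟨a, ha, rfl⟩⟩ := by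
  induction ha using Submodule.pow_induction_on_left' with
  | algebraMap r =>
    rw [AlgHom.commutes, DirectSum.algebraMap_apply]
    exact DirectSum.of_eq_of_gradedMonoid_eq
      (Sigma.subtype_ext rfl ((AbelianModel.mk Γ).commutes r).symm)
  | add a b i ha hb iha ihb =>
    rw [map_add, iha, ihb, ← map_add]
    congr 1
    exact Subtype.ext (map_add (AbelianModel.mk Γ) a b).symm
  | mem_mul m hm i a ha ih =>
    obtain ⟨m, rfl⟩ := hm
    rw [map_mul, ih, decomposeExt, ExteriorAlgebra.lift_ι_apply, decomposeι_apply,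
      DirectSum.of_mul_of]
    exact DirectSum.of_eq_of_gradedMonoid_eq
      (Sigma.subtype_ext (add_comm _ _) (map_mul (AbelianModel.mk Γ) _ a).symm)

noncomputable instance AbelianModel.gradedAlgebra : GradedAlgebra (AbelianModel.grading Γ) :=
  GradedAlgebra.ofAlgHom _
    (RingQuot.liftAlgHom ℚ ⟨decomposeExt Γ, fun a b h => by
      obtain ⟨rfl, n, hn⟩ := h.homogeneous
      rw [map_zero, decomposeExt_eq Γ n a hn]
      refine DFinsupp.single_eq_zero.mpr (Subtype.ext ?_)
      exact (RingQuot.mkAlgHom_rel ℚ h).trans (map_zero _)⟩)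
    (by
      refine RingQuot.ringQuot_ext' _ _ _ (ExteriorAlgebra.hom_ext (LinearMap.ext fun m => ?_))
      change DirectSum.coeAlgHom _ (RingQuot.liftAlgHom ℚ _
        (RingQuot.mkAlgHom ℚ (ModelRel Γ) (ExteriorAlgebra.ι ℚ m))) = AbelianModel.mk Γ _
      rw [RingQuot.liftAlgHom_mkAlgHom_apply, decomposeExt, ExteriorAlgebra.lift_ι_apply,
        decomposeι_apply, DirectSum.coeAlgHom_of])
    (by
      rintro i ⟨_, a, ha, rfl⟩
      change RingQuot.liftAlgHom ℚ _ (RingQuot.mkAlgHom ℚ (ModelRel Γ) a) = _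
      rw [RingQuot.liftAlgHom_mkAlgHom_apply]
      exact decomposeExt_eq Γ i a ha)

end Model

end SimpleGraph

/-! The proof constructs a Koszul filtration. Let `F` be a set of left ideals containing `A⁺`, each
of which is built from `0` by adjoining degree-one elements `l` one at a time, with every colon
ideal `K : l` again in `F`. Covering such an ideal by a free module leaves a kernel with a
filtration of the same kind (`LinearFiltration.lift`), so iteration yields a linear resolution
(`isKoszul_of_linearFiltration`).

Chordality supplies a perfect elimination order `o`: the earlier neighbours `U_v` of each vertex `v`
form a clique. The ideals in `F` are generated by all generators living on the first `n` vertices,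
or by those together with the `g_{uv}`, `u ∈ U_v`, and `x_v`. When the `g_{uv}`, then `x_v`, then
`y_v` are adjoined, anticommutativity and the edge and triangle relations put an explicit ideal of
`F` inside each colon ideal. Equality comes from counting dimensions: as `dim A/K = dim A/(K + Al) +
dim A/(K : l)`, these inclusions give `dim A ≤ ∏ (|U_v| + 4)`, and if the bound is attained no colon
ideal can be larger (`LinearFiltration.fibration_step`).

The bound is attained because `A` acts on a cyclic module of that dimension, built vertex by vertex:
`M` is replaced by copies of `M` labelled `1, x_v, y_v, x_v y_v, g_{uv}`
(`IsPerfectElimination.exists_module`). For `A` to act, all cycle relations must hold; they follow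
from the triangle relations by cutting a closed walk short at its `o`-last vertex
(`IsModelSystem.alternatingSum_closedWalk`). The given order on the vertices affects the relations
only by signs, so it need not be related to `o`. -/

/-! ## Linear filtrations and the Koszul property -/

section KoszulFiltration

universe u v

/-- A submodule has a *linear filtration* with respect to a set `L` of (degree one) elements and a
set `F` of left ideals if it is obtained from `⊥` by successively adjoining elements of `L` with
colon ideals in `F`. -/
inductive LinearFiltration {A : Type*} [Ring A] (F : Set (Ideal A)) {M : Type*} [AddCommGroup M]
    [Module A M] (L : Set M) : Submodule A M → Prop
  | bot : LinearFiltration F L ⊥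
  | step (K : Submodule A M) (l : M) : LinearFiltration F L K → l ∈ L → K.colon {l} ∈ F →
      LinearFiltration F L (K ⊔ Submodule.span A {l})

theorem LinearFiltration.map {A : Type*} [Ring A] {F : Set (Ideal A)} {M N : Type*}
    [AddCommGroup M] [Module A M] [AddCommGroup N] [Module A N] {L : Set M} {L' : Set N}
    {K : Submodule A M} (h : LinearFiltration F L K) (φ : M →ₗ[A] N) (hφ : Function.Injective φ)
    (hL : ∀ l ∈ L, φ l ∈ L') : LinearFiltration F L' (K.map φ) := by
  induction h with
  | bot => rw [Submodule.map_bot]; exact .bot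
  | step K l _ hl hc ih =>
    rw [Submodule.map_sup, Submodule.map_span, Set.image_singleton]
    refine .step _ _ ih (hL l hl) ?_
    convert hc using 1
    ext a
    rw [Submodule.mem_colon_singleton, Submodule.mem_colon_singleton, ← map_smul,
      ← SetLike.mem_coe, Submodule.map_coe, hφ.mem_set_image, SetLike.mem_coe]

variable {k : Type u} {A : Type v} [Field k] [Ring A] [Algebra k A] (𝒜 : ℕ → Submodule k A)

/-- The elements of a free module all of whose coordinates have degree one. -/
def linearElements (ι : Type*) : Set (ι →₀ A) := {f | ∀ i, f i ∈ 𝒜 1}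

variable [GradedAlgebra 𝒜]

/-- If the linear form `c • l` (with `c` and the coordinates of `l` of degree one) is in the image
of a linear map, it is the image of an element with coordinates of degree one. -/
theorem exists_linear_preimage {ι κ : Type*} (d : (κ →₀ A) →ₗ[A] (ι →₀ A))
    (hd : ∀ i, d (Finsupp.single i 1) ∈ linearElements 𝒜 ι) {c : A} (hc : c ∈ 𝒜 1) {l : ι →₀ A}
    (hl : l ∈ linearElements 𝒜 ι) (h : c • l ∈ LinearMap.range d) :
    ∃ f ∈ linearElements 𝒜 κ, d f = c • l := by
  obtain ⟨f, hf⟩ := h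
  have hsum (g : κ →₀ A) (j : ι) : d g j = g.sum fun i a => a * d (Finsupp.single i 1) j := by
    conv_lhs => rw [← g.sum_single]
    rw [map_finsuppSum, Finsupp.sum, Finsupp.finsetSum_apply, Finsupp.sum]
    refine Finset.sum_congr rfl fun i _ => ?_
    rw [← mul_one (g i), ← smul_eq_mul, ← Finsupp.smul_single, map_smul, Finsupp.smul_apply,
      smul_eq_mul, smul_eq_mul, mul_one]
  -- The entries of `d` have degree one, so only the degree-one parts of the coordinates of `f`
  -- reach degree two, where `c • l` lives.
  refine ⟨f.mapRange (fun a => (DirectSum.decompose 𝒜 a 1 : A)) (by simp), fun i => ?_, ?_⟩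
  · rw [Finsupp.mapRange_apply]; exact SetLike.coe_mem _
  · ext j
    have h2 : ((DirectSum.decompose 𝒜 (d f j) (1 + 1) : 𝒜 (1 + 1)) : A) = c * l j := by
      rw [hf, Finsupp.smul_apply, smul_eq_mul]
      exact DirectSum.decompose_of_mem_same 𝒜 (SetLike.GradedMul.mul_mem hc (hl j))
    rw [Finsupp.smul_apply, smul_eq_mul, ← h2, hsum, hsum, Finsupp.sum_mapRange_index (by simp),
      Finsupp.sum, Finsupp.sum, DirectSum.decompose_sum, DFinsupp.finsetSum_apply,
      AddSubmonoidClass.coe_finsetSum]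
    exact Finset.sum_congr rfl fun i _ =>
      (DirectSum.coe_decompose_mul_add_of_right_mem 𝒜 (hd i j)).symm

variable {𝒜}

/-- With `I = K : l` this filters the middle term of `0 → ker d → ker d' → K : l → 0`. The general
`I` makes induction along the filtration of `K : l` possible: `I = ⊥` gives `ker d`, and each
further generator of `I` contributes one linear syzygy. -/
theorem LinearFiltration.lift {F : Set (Ideal A)} {ι κ : Type*} {K : Submodule A (ι →₀ A)}
    {l : ι →₀ A} (hl : l ∈ linearElements 𝒜 ι) (d : (κ →₀ A) →ₗ[A] (ι →₀ A))
    (hd : ∀ i, d (Finsupp.single i 1) ∈ linearElements 𝒜 ι) (hK : LinearMap.range d = K)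
    (hker : LinearFiltration F (linearElements 𝒜 κ) (LinearMap.ker d))
    (d' : (Option κ →₀ A) →ₗ[A] (ι →₀ A)) (hl' : d' (Finsupp.single none 1) = l)
    (hd' : d' ∘ₗ Finsupp.lmapDomain A A some = d) {I : Ideal A}
    (hI : LinearFiltration F (𝒜 1 : Set A) I) (hle : I ≤ K.colon {l}) :
    LinearFiltration F (linearElements 𝒜 (Option κ))
      (LinearMap.ker d' ⊓ Submodule.comap (Finsupp.lapply none : (Option κ →₀ A) →ₗ[A] A) I) := by
  have hsome : Function.Injective (some : κ → Option κ) := Option.some_injective κ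
  have hnone (f : κ →₀ A) : f.mapDomain some none = 0 := Finsupp.mapDomain_of_notMem_range _ _ (by simp)
  have hlin (f : κ →₀ A) (hf : f ∈ linearElements 𝒜 κ) :
      f.mapDomain some ∈ linearElements 𝒜 (Option κ) := by
    rintro (_ | i)
    · rw [hnone]; exact zero_mem _
    · rw [Finsupp.mapDomain_apply hsome]; exact hf i
  have hcomp (f : κ →₀ A) : d' (f.mapDomain some) = d f := LinearMap.congr_fun hd' f
  induction hI with
  | bot =>
    convert hker.map (L' := linearElements 𝒜 (Option κ)) (Finsupp.lmapDomain A A some)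
      (Finsupp.mapDomain_injective hsome) hlin using 1
    ext f
    simp only [Submodule.mem_inf, LinearMap.mem_ker, Submodule.mem_comap, Submodule.mem_bot,
      Submodule.mem_map, Finsupp.lapply_apply, Finsupp.lmapDomain_apply]
    constructor
    · rintro ⟨h1, h2⟩
      have hf : f = (f.comapDomain some hsome.injOn).mapDomain some := by
        ext (_ | i)
        · rw [h2, hnone]
        · rw [Finsupp.mapDomain_apply hsome, Finsupp.comapDomain_apply]
      exact ⟨_, by rw [← hcomp, ← hf, h1], hf.symm⟩
    · rintro ⟨g, hg, rfl⟩
      exact ⟨by rw [hcomp, hg], hnone g⟩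
  | step I c hI hc hcF ih =>
    obtain ⟨f, hf, hfc⟩ := exists_linear_preimage 𝒜 d hd hc hl (by
      rw [hK]
      exact Submodule.mem_colon_singleton.1
        (hle (Submodule.mem_sup_right (Submodule.mem_span_singleton_self c))))
    -- The syzygy expressing `c • l ∈ K`. Its `none` coordinate is `c` and it lies in `ker d'`, so
    -- the colon ideal of the previous stage by `z` is `I : c`.
    set z : Option κ →₀ A := Finsupp.single none c - f.mapDomain some with hz
    have hz0 : z none = c := by simp [hz, hnone]
    have hzker : d' z = 0 := by
      rw [hz, map_sub, hcomp, hfc, ← mul_one c, ← smul_eq_mul, ← Finsupp.smul_single, map_smul, hl',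
        smul_eq_mul, mul_one, sub_self]
    have hzlin : z ∈ linearElements 𝒜 (Option κ) := by
      rintro (_ | i)
      · rw [hz0]; exact hc
      · have := hlin f hf (some i)
        simpa [hz] using this
    convert LinearFiltration.step _ z (ih (le_sup_left.trans hle)) hzlin ?_ using 1
    · ext g
      simp only [Submodule.mem_inf, LinearMap.mem_ker, Submodule.mem_comap, Finsupp.lapply_apply,
        Submodule.mem_sup, Submodule.mem_span_singleton]
      constructor
      · rintro ⟨h1, y, hy, _, ⟨a, rfl⟩, hya⟩
        refine ⟨g - a • z, ⟨by rw [map_sub, map_smul, h1, hzker, smul_zero, sub_zero], ?_⟩, a • z,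
          ⟨a, rfl⟩, sub_add_cancel _ _⟩
        rwa [Finsupp.sub_apply, Finsupp.smul_apply, hz0, ← hya, add_sub_cancel_right]
      · rintro ⟨y, ⟨hy, hyI⟩, _, ⟨a, rfl⟩, rfl⟩
        exact ⟨by rw [map_add, map_smul, hy, hzker, smul_zero, zero_add], y none, hyI, a • c,
          ⟨a, rfl⟩, by rw [Finsupp.add_apply, Finsupp.smul_apply, hz0]⟩
    · convert hcF using 1
      ext a
      simp only [Submodule.mem_colon_singleton, Submodule.mem_inf, LinearMap.mem_ker, map_smul,
        hzker, smul_zero, true_and, Submodule.mem_comap, Finsupp.lapply_apply, hz0]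

/-- A submodule of a free module with a linear filtration is the image of a linear map from a free
module, the kernel of which again has a linear filtration. -/
theorem LinearFiltration.exists_cover {F : Set (Ideal A)}
    (hF : ∀ I ∈ F, LinearFiltration F (𝒜 1 : Set A) I) {ι : Type v} {K : Submodule A (ι →₀ A)}
    (h : LinearFiltration F (linearElements 𝒜 ι) K) :
    ∃ (κ : Type v) (d : (κ →₀ A) →ₗ[A] (ι →₀ A)),
      (∀ i, d (Finsupp.single i 1) ∈ linearElements 𝒜 ι) ∧ LinearMap.range d = K ∧
      LinearFiltration F (linearElements 𝒜 κ) (LinearMap.ker d) := by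
  induction h with
  | bot =>
    refine ⟨PEmpty, 0, fun i => i.elim, LinearMap.range_zero, ?_⟩
    rw [Subsingleton.elim (LinearMap.ker _) ⊥]
    exact .bot
  | step K l _ hl hc ih =>
    obtain ⟨κ, d, hd, hK, hker⟩ := ih
    set d' : (Option κ →₀ A) →ₗ[A] (ι →₀ A) :=
      Finsupp.linearCombination A fun o => o.elim l fun i => d (Finsupp.single i 1) with hd'
    have hl' : d' (Finsupp.single none 1) = l := by simp [hd']
    have hs (i : κ) : d' (Finsupp.single (some i) 1) = d (Finsupp.single i 1) := by simp [hd']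
    have hcomp : d' ∘ₗ Finsupp.lmapDomain A A some = d := by
      ext i : 2
      simp [hs]
    refine ⟨Option κ, d', ?_, ?_, ?_⟩
    · rintro (_ | i)
      · rwa [hl']
      · rw [hs]; exact hd i
    · rw [hd', Finsupp.range_linearCombination, ← hK, sup_comm]
      have : Set.range (fun o : Option κ => o.elim l fun i => d (Finsupp.single i 1)) =
          {l} ∪ Set.range fun i => d (Finsupp.single i 1) := by
        ext x
        simp [Option.exists, eq_comm]
      rw [this, Submodule.span_union]
      congr 1
      rw [Set.range_comp' d, ← Submodule.map_span, LinearMap.range_eq_map]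
      congr 1
      exact (Finsupp.basisSingleOne (R := A) (ι := κ)).span_eq.symm ▸ by simp
    · convert LinearFiltration.lift hl d hd hK hker d' hl' hcomp (hF _ hc) le_rfl using 1
      -- For `I = K : l` the condition on the `none` coordinate is automatic: `d' f = 0` forces `f
      -- none • l` into the range of `d`, which is `K`.
      refine (inf_eq_left.2 fun f hf => ?_).symm
      rw [Submodule.mem_comap, Submodule.mem_colon_singleton]
      have hf' : f = Finsupp.single none (f none) +
          (f.comapDomain some (Option.some_injective κ).injOn).mapDomain some := by
        ext (_ | i)
        · simp [Finsupp.mapDomain_of_notMem_range]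
        · simp [Finsupp.mapDomain_apply (Option.some_injective κ)]
      have h0 : d' f = f none • l + d (f.comapDomain some (Option.some_injective κ).injOn) := by
        conv_lhs => rw [hf', ← mul_one (f none), ← smul_eq_mul, ← Finsupp.smul_single, map_add,
          map_smul, hl']
        congr 1
        exact LinearMap.congr_fun hcomp _
      rw [LinearMap.mem_ker.1 hf] at h0
      rw [Finsupp.lapply_apply, eq_neg_of_add_eq_zero_left h0.symm, ← hK]
      exact neg_mem (LinearMap.mem_range_self _ _)

/-- A connected graded algebra is Koszul if its augmentation ideal belongs to a set of left ideals
each of which has a linear filtration with colon ideals in this set. -/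
theorem isKoszul_of_linearFiltration [Nontrivial A] (h0 : 𝒜 0 = 1) (F : Set (Ideal A))
    (hF : ∀ I ∈ F, LinearFiltration F (𝒜 1 : Set A) I)
    (hirr : (HomogeneousIdeal.irrelevant 𝒜).toIdeal ∈ F) : IsKoszul 𝒜 := by
  refine ⟨inferInstance, h0, ?_⟩
  let S := {p : Σ ι : Type v, Submodule A (ι →₀ A) //
    LinearFiltration F (linearElements 𝒜 p.1) p.2}
  let I := (HomogeneousIdeal.irrelevant 𝒜).toIdeal
  -- The iteration starts at `A⁺` inside the free module of rank one, the kernel of the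
  -- augmentation; the kernel of each cover is the module to be covered next.
  let p0 : S := ⟨⟨PUnit, Submodule.map (Finsupp.lsingle PUnit.unit : A →ₗ[A] (PUnit →₀ A)) I⟩,
    (hF _ hirr).map _ (Finsupp.single_injective _) fun l hl i => by simpa using hl⟩
  have hS (p : S) : ∃ (q : S) (d : (q.1.1 →₀ A) →ₗ[A] (p.1.1 →₀ A)),
      (∀ i, d (Finsupp.single i 1) ∈ linearElements 𝒜 p.1.1) ∧ LinearMap.range d = p.1.2 ∧
      LinearMap.ker d = q.1.2 := by
    obtain ⟨κ, d, h1, h2, h3⟩ := p.2.exists_cover hF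
    exact ⟨⟨⟨κ, LinearMap.ker d⟩, h3⟩, d, h1, h2, rfl⟩
  choose q d hd hr hk using hS
  let s : ℕ → S := fun n => Nat.rec p0 (fun _ p => q p) n
  refine ⟨fun n => (s n).1.1, I.mkQ ∘ₗ Finsupp.lapply PUnit.unit, fun n => d (s n),
    fun n i j => hd (s n) i j, ?_, ?_, fun n => ?_⟩
  · exact (Submodule.mkQ_surjective I).comp fun a =>
      ⟨Finsupp.single PUnit.unit a, Finsupp.single_eq_same⟩
  · refine LinearMap.exact_iff.2 ((?_ : _ = _).trans (hr (s 0)).symm)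
    ext f
    rw [LinearMap.mem_ker, LinearMap.comp_apply, Submodule.mkQ_apply, Submodule.Quotient.mk_eq_zero]
    constructor
    · exact fun h => ⟨_, h, by ext; simp⟩
    · rintro ⟨a, ha, rfl⟩
      simpa using ha
  · exact LinearMap.exact_iff.2 ((hk (s n)).trans (hr (s (n + 1))).symm)

end KoszulFiltration

/-! ## Colon ideals and dimensions -/

section Codimension

universe u v

variable (k : Type u) {A : Type v} [Field k] [Ring A] [Algebra k A]

theorem finrank_eq_add_of_ker_eq_range {X Y Z : Type*} [AddCommGroup X] [AddCommGroup Y]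
    [AddCommGroup Z] [Module A X] [Module A Y] [Module A Z] [Module k X] [Module k Y] [Module k Z]
    [IsScalarTower k A X] [IsScalarTower k A Y] [IsScalarTower k A Z] [Module.Finite k Y]
    (f : X →ₗ[A] Y) (h : Y →ₗ[A] Z) (hf : Function.Injective f) (hh : Function.Surjective h)
    (hker : LinearMap.ker h = LinearMap.range f) :
    Module.finrank k Y = Module.finrank k Z + Module.finrank k X := by
  have h3 : LinearMap.ker (h.restrictScalars k) = LinearMap.range (f.restrictScalars k) := by
    ext a
    exact SetLike.ext_iff.1 hker a
  rw [← LinearMap.finrank_range_add_finrank_ker (h.restrictScalars k), h3,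
    LinearMap.finrank_range_of_inj (f := f.restrictScalars k) hf,
    LinearMap.range_eq_top.2 (show Function.Surjective (h.restrictScalars k) from hh), finrank_top]

variable [Module.Finite k A]

theorem finite_quotient_ideal (I : Ideal A) : Module.Finite k (A ⧸ I) :=
  Module.Finite.of_surjective (I.mkQ.restrictScalars k) (Submodule.mkQ_surjective I)

theorem finrank_quotient_le_of_le {I J : Ideal A} (h : I ≤ J) :
    Module.finrank k (A ⧸ J) ≤ Module.finrank k (A ⧸ I) :=
  have := finite_quotient_ideal k I
  LinearMap.finrank_le_finrank_of_surjective (f := (Submodule.factor h).restrictScalars k)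
    (Submodule.factor_surjective h)

theorem eq_of_le_of_finrank_quotient_le {I J : Ideal A} (h : I ≤ J)
    (hd : Module.finrank k (A ⧸ I) ≤ Module.finrank k (A ⧸ J)) : I = J := by
  have := finite_quotient_ideal k I
  have := finite_quotient_ideal k J
  refine le_antisymm h fun a ha => ?_
  have hinj : Function.Injective ((Submodule.factor h).restrictScalars k) :=
    (LinearMap.injective_iff_surjective_of_finrank_eq_finrank
      (le_antisymm hd (finrank_quotient_le_of_le k h))).2 (Submodule.factor_surjective h)
  rw [← Submodule.Quotient.mk_eq_zero I]
  refine hinj ?_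
  rw [map_zero]
  exact (Submodule.Quotient.mk_eq_zero J).2 ha

/-- The exact sequence `0 → A / (K : l) → A / K → A / (K + A l) → 0`, numerically. -/
theorem finrank_quotient_eq_add_colon (K : Ideal A) (l : A) :
    Module.finrank k (A ⧸ K) =
      Module.finrank k (A ⧸ K ⊔ Submodule.span A {l}) + Module.finrank k (A ⧸ K.colon {l}) := by
  have := finite_quotient_ideal k K
  let f : A ⧸ K.colon {l} →ₗ[A] A ⧸ K :=
    (K.colon {l}).liftQ (K.mkQ ∘ₗ LinearMap.toSpanSingleton A A l) fun a ha =>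
      (Submodule.Quotient.mk_eq_zero K).2 (Submodule.mem_colon_singleton.1 ha)
  have hf : Function.Injective f := by
    refine LinearMap.ker_eq_bot.1 (Submodule.ker_liftQ_eq_bot _ _ _ fun a ha => ?_)
    exact Submodule.mem_colon_singleton.2 ((Submodule.Quotient.mk_eq_zero K).1 ha)
  let h : A ⧸ K →ₗ[A] A ⧸ K ⊔ Submodule.span A {l} := Submodule.factor le_sup_left
  have hker : LinearMap.ker h = LinearMap.range f := by
    ext a
    obtain ⟨a, rfl⟩ := Submodule.mkQ_surjective K a
    rw [LinearMap.mem_ker]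
    change Submodule.Quotient.mk a = 0 ↔ _
    rw [Submodule.Quotient.mk_eq_zero, Submodule.mem_sup]
    constructor
    · rintro ⟨y, hy, z, hz, rfl⟩
      obtain ⟨b, rfl⟩ := Submodule.mem_span_singleton.1 hz
      refine ⟨Submodule.Quotient.mk b, ?_⟩
      rw [map_add, (LinearMap.mem_ker.1 ((Submodule.ker_mkQ K).symm ▸ hy) : K.mkQ y = 0), zero_add]
      rfl
    · rintro ⟨b, hb⟩
      obtain ⟨b, rfl⟩ := Submodule.mkQ_surjective _ b
      have hb' : K.mkQ (b • l) = K.mkQ a := hb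
      have : a - b • l ∈ K := by
        rw [← Submodule.ker_mkQ K, LinearMap.mem_ker, map_sub, hb', sub_self]
      exact ⟨_, this, _, Submodule.mem_span_singleton.2 ⟨b, rfl⟩, sub_add_cancel _ _⟩
  exact finrank_eq_add_of_ker_eq_range k f h hf (Submodule.factor_surjective le_sup_left) hker

/-- Elements known to lie in a colon ideal bound the codimension of `K` from above; the next lemma
exploits the case of equality. -/
theorem finrank_quotient_le_add {I K : Ideal A} {l : A} (h : I ≤ K.colon {l}) :
    Module.finrank k (A ⧸ K) ≤
      Module.finrank k (A ⧸ K ⊔ Submodule.span A {l}) + Module.finrank k (A ⧸ I) := by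
  rw [finrank_quotient_eq_add_colon k K l]
  exact Nat.add_le_add_left (finrank_quotient_le_of_le k h) _

theorem colon_eq_of_add_le_finrank_quotient {I K : Ideal A} {l : A} (h : I ≤ K.colon {l})
    (hd : Module.finrank k (A ⧸ K ⊔ Submodule.span A {l}) + Module.finrank k (A ⧸ I) ≤
      Module.finrank k (A ⧸ K)) : K.colon {l} = I := by
  refine (eq_of_le_of_finrank_quotient_le k h ?_).symm
  rw [finrank_quotient_eq_add_colon k K l] at hd
  exact Nat.le_of_add_le_add_left hd

variable {α : Type*} [DecidableEq α] {g : α → A} {x y : A} {L L' : Ideal A} {U : Finset α}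

theorem span_image_insert_sup (L : Ideal A) (g : α → A) (U : Finset α) (w : α) :
    L ⊔ Submodule.span A (g '' (insert w U : Finset α)) =
      L ⊔ Submodule.span A (g '' U) ⊔ Submodule.span A {g w} := by
  rw [Finset.coe_insert, Set.image_insert_eq, Submodule.span_insert, sup_assoc,
    sup_comm (Submodule.span A {g w})]

/-- Each `g w` costs at most `dim A/L'`, since enlarging `L` only enlarges the colon ideal by `g w`.
-/
theorem finrank_quotient_le_card_mul (hg : ∀ w ∈ U, L' ≤ L.colon {g w}) :
    Module.finrank k (A ⧸ L) ≤ Module.finrank k (A ⧸ L ⊔ Submodule.span A (g '' U)) +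
      U.card * Module.finrank k (A ⧸ L') := by
  induction U using Finset.induction_on with
  | empty =>
    rw [Finset.coe_empty, Set.image_empty, Submodule.span_empty, sup_bot_eq]
    exact Nat.le_add_right _ _
  | insert w U hw ih =>
    have h1 := ih fun u hu => hg u (Finset.mem_insert_of_mem hu)
    have h2 := finrank_quotient_le_add k (K := L ⊔ Submodule.span A (g '' U)) (l := g w)
      ((hg w (Finset.mem_insert_self w U)).trans (Submodule.colon_mono le_sup_left le_rfl))
    rw [span_image_insert_sup, Finset.card_insert_of_notMem hw]
    linarith

/-- The dimension estimate for one step of a fibration: passing from `L` to `L'` by adjoining the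
elements `g w`, `x` and `y` in this order. -/
theorem finrank_quotient_le_card_add_four_mul (hg : ∀ w ∈ U, L' ≤ L.colon {g w})
    (hx : L ⊔ Submodule.span A (g '' U) ⊔ Submodule.span A {x} ≤
      (L ⊔ Submodule.span A (g '' U)).colon {x})
    (hy : L' ≤ (L ⊔ Submodule.span A (g '' U) ⊔ Submodule.span A {x}).colon {y})
    (hL' : L ⊔ Submodule.span A (g '' U) ⊔ Submodule.span A {x} ⊔ Submodule.span A {y} = L') :
    Module.finrank k (A ⧸ L) ≤ (U.card + 4) * Module.finrank k (A ⧸ L') := by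
  have h1 := finrank_quotient_le_card_mul k hg
  have h2 := finrank_quotient_le_add k hx
  have h3 := finrank_quotient_le_add k hy
  rw [hL'] at h3
  linarith

/-- If the dimension estimate for one step of a fibration is sharp, then all the colon ideals are as
small as possible, and linear filtrations extend. -/
theorem LinearFiltration.fibration_step (hg : ∀ w ∈ U, L' ≤ L.colon {g w})
    (hx : L ⊔ Submodule.span A (g '' U) ⊔ Submodule.span A {x} ≤
      (L ⊔ Submodule.span A (g '' U)).colon {x})
    (hy : L' ≤ (L ⊔ Submodule.span A (g '' U) ⊔ Submodule.span A {x}).colon {y})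
    (hL' : L ⊔ Submodule.span A (g '' U) ⊔ Submodule.span A {x} ⊔ Submodule.span A {y} = L')
    (hd : (U.card + 4) * Module.finrank k (A ⧸ L') ≤ Module.finrank k (A ⧸ L))
    {F : Set (Ideal A)} {S : Set A} (hF' : L' ∈ F)
    (hF : L ⊔ Submodule.span A (g '' U) ⊔ Submodule.span A {x} ∈ F)
    (hgS : ∀ w ∈ U, g w ∈ S) (hxS : x ∈ S) (hyS : y ∈ S) (h : LinearFiltration F S L) :
    LinearFiltration F S (L ⊔ Submodule.span A (g '' U) ⊔ Submodule.span A {x}) ∧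
      LinearFiltration F S L' := by
  have h2 := finrank_quotient_le_add k hx
  have h3 := finrank_quotient_le_add k hy
  rw [hL'] at h3
  have hU : ∀ W ⊆ U, LinearFiltration F S (L ⊔ Submodule.span A (g '' W)) := by
    intro W
    induction W using Finset.induction_on with
    | empty =>
      intro _
      rwa [Finset.coe_empty, Set.image_empty, Submodule.span_empty, sup_bot_eq]
    | insert w W hw ih =>
      intro hWU
      have hwU : w ∈ U := hWU (Finset.mem_insert_self w W)
      have hW : W ⊆ U := (Finset.subset_insert w W).trans hWU
      have hcol : L' ≤ (L ⊔ Submodule.span A (g '' W)).colon {g w} :=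
        (hg w hwU).trans (Submodule.colon_mono le_sup_left le_rfl)
      -- The elements before and after `w` each cost at most `dim A/L'`, and `x`, `y` together
      -- account for at most `4 · dim A/L'`. Since the total `|U| + 4` is attained, nothing is left
      -- for the colon ideal by `g w` to exceed `L'`.
      have e1 := finrank_quotient_le_card_mul k fun u hu => hg u (hW hu)
      have e2 := finrank_quotient_le_card_mul k (L := L ⊔ Submodule.span A (g '' (insert w W : Finset α)))
        (U := U \ insert w W) (g := g) (L' := L') fun u hu =>
          (hg u (Finset.sdiff_subset hu)).trans (Submodule.colon_mono le_sup_left le_rfl)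
      rw [sup_assoc, ← Submodule.span_union, ← Set.image_union, ← Finset.coe_union,
        Finset.union_sdiff_of_subset hWU] at e2
      have e3 := Finset.card_sdiff_add_card_eq_card hWU
      rw [Finset.card_insert_of_notMem hw] at e3
      rw [span_image_insert_sup] at e2 ⊢
      refine .step _ _ (ih hW) (hgS w hwU) ?_
      rwa [colon_eq_of_add_le_finrank_quotient k hcol]
      rw [← e3] at hd
      nlinarith
  -- What remains after the `g w` has codimension at least `4 · dim A/L'`, while `x` and `y` each at
  -- most double the codimension; hence both doublings are exact.
  have e1 := finrank_quotient_le_card_mul k hg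
  have hX : LinearFiltration F S (L ⊔ Submodule.span A (g '' U) ⊔ Submodule.span A {x}) := by
    refine .step _ _ (hU U subset_rfl) hxS ?_
    rwa [colon_eq_of_add_le_finrank_quotient k hx]
    linarith
  refine ⟨hX, ?_⟩
  rw [← hL']
  refine .step _ _ hX hyS ?_
  rwa [colon_eq_of_add_le_finrank_quotient k hy]
  rw [hL']
  linarith

end Codimension

/-! ## Perfect elimination orders of chordal graphs -/

namespace SimpleGraph

section Chordal

variable {V : Type*} {Γ : SimpleGraph V}

/-- A chord would be a shortcut. -/
theorem Walk.isChordless_of_length_eq_dist {u v : V} {p : Γ.Walk u v}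
    (hp : p.length = Γ.dist u v) : p.IsChordless := by
  have key (i j : ℕ) (hij : i ≤ j) (hj : j ≤ p.length) (h : Γ.Adj (p.getVert i) (p.getVert j)) :
      s(p.getVert i, p.getVert j) ∈ p.edges := by
    have h1 := dist_le ((p.take i).append (.cons h (p.drop j)))
    rw [Walk.length_append, Walk.length_cons, Walk.take_length, Walk.drop_length, ← hp] at h1
    have hne : i ≠ j := by rintro rfl; exact h.ne rfl
    obtain rfl : j = i + 1 := by omega
    exact (Walk.mk_mem_edges_iff_exists p).2 ⟨i, by omega, rfl⟩
  rw [Walk.isChordless_iff_forall_mem_edges]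
  intro a b ha hb hab
  obtain ⟨i, rfl, hi⟩ := Walk.mem_support_iff_exists_getVert.1 ha
  obtain ⟨j, rfl, hj⟩ := Walk.mem_support_iff_exists_getVert.1 hb
  rcases le_total i j with hij | hij
  · exact key i j hij hj hab
  · rw [Sym2.eq_swap]; exact key j i hij hi hab.symm

/-- In a chordal graph, two vertices with neighbours in a connected set `H` are adjacent if they
have a common neighbour outside the closed neighbourhood of `H`. -/
theorem IsChordal.adj_of_connected (hΓ : Γ.IsChordal) {H : Set V} (hH : (Γ.induce H).Connected)
    {s t r : V} (hst : s ≠ t) (hsH : ∃ h ∈ H, Γ.Adj s h) (htH : ∃ h ∈ H, Γ.Adj t h)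
    (hr : r ∉ H) (hrH : ∀ h ∈ H, ¬ Γ.Adj r h) (hrs : Γ.Adj r s) (hrt : Γ.Adj r t) :
    Γ.Adj s t := by
  by_contra hadj
  obtain ⟨a, haH, hsa⟩ := hsH
  obtain ⟨b, hbH, htb⟩ := htH
  have hconn : (Γ.induce ({s, a} ∪ (H ∪ {t, b}))).Connected := by
    have h1 : (Γ.induce (H ∪ {t, b})).Connected :=
      induce_union_connected hH.preconnected (induce_pair_connected_of_adj htb).preconnected
        ⟨b, hbH, by simp⟩
    exact induce_union_connected (induce_pair_connected_of_adj hsa).preconnected h1.preconnected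
      ⟨a, by simp, Or.inl haH⟩
  set T : Set V := {s, a} ∪ (H ∪ {t, b}) with hT
  have hTmem (v : V) (hv : v ∈ T) : v ∈ H ∨ v = s ∨ v = t := by
    rcases hv with (rfl | rfl) | hv | rfl | rfl <;> simp_all
  have hrT : r ∉ T := fun h => by
    rcases hTmem r h with h | rfl | rfl
    · exact hr h
    · exact hrs.ne rfl
    · exact hrt.ne rfl
  let s' : T := ⟨s, by simp [hT]⟩
  let t' : T := ⟨t, by simp [hT]⟩
  -- If `s` and `t` are not adjacent, a shortest path between them through `H` has length at least
  -- two and closes up with `r` to a cycle of length at least four. The path has no chord, and on it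
  -- `r` is adjacent only to `s` and `t`, so the cycle has no chord.
  obtain ⟨p, hp, hpd⟩ := hconn.exists_path_of_dist s' t'
  have hless := Walk.isChordless_of_length_eq_dist hpd
  let φ : Γ.induce T ↪g Γ := Embedding.induce T
  let q : Γ.Walk s t := p.map φ.toHom
  have hq : q.IsPath := hp.map φ.injective
  have hqT : ∀ v ∈ q.support, ∃ v' ∈ p.support, (v' : V) = v := fun v hv => by
    have hv := (Walk.support_map φ.toHom p) ▸ hv
    obtain ⟨v', hv', rfl⟩ := List.mem_map.1 hv
    exact ⟨v', hv', rfl⟩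
  have hrq : r ∉ q.support := fun h => by
    obtain ⟨v', -, hv⟩ := hqT r h
    exact hrT (hv ▸ v'.2)
  have hlen : 2 ≤ q.length := by
    by_contra! hlt
    interval_cases hl : q.length
    · exact hst (Walk.eq_of_length_eq_zero hl)
    · exact hadj (Walk.adj_of_length_eq_one hl)
  have hcyc : (Walk.cons hrs (q.concat hrt.symm)).IsCycle := by
    refine (Walk.cons_isCycle_iff _ _).2 ⟨hq.concat hrq _, fun h => ?_⟩
    rw [Walk.edges_concat, List.concat_eq_append, List.mem_append, List.mem_singleton] at h
    rcases h with h | h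
    · exact hrq (q.fst_mem_support_of_mem_edges h)
    · rcases Sym2.eq_iff.1 h with ⟨rfl, -⟩ | ⟨-, rfl⟩
      · exact hrt.ne rfl
      · exact hst rfl
  obtain ⟨e, he⟩ := hΓ r _ hcyc (by rw [Walk.length_cons, Walk.length_concat]; omega)
  induction e with | _ u v =>
  rw [Walk.isChord_sym2Mk] at he
  simp only [Walk.edges_cons, Walk.edges_concat, List.concat_eq_append, List.mem_cons,
    List.mem_append, List.not_mem_nil, or_false, Walk.support_cons, Walk.support_concat] at he
  obtain ⟨huv, hne, hu, hv⟩ := he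
  have hnr (v : V) (hv : v ∈ q.support) (hadj : Γ.Adj r v) : v = s ∨ v = t := by
    obtain ⟨v', -, rfl⟩ := hqT v hv
    exact (hTmem _ v'.2).resolve_left fun h => hrH _ h hadj
  have hu' : u = r ∨ u ∈ q.support := by tauto
  have hv' : v = r ∨ v ∈ q.support := by tauto
  rcases hu' with rfl | hu' <;> rcases hv' with rfl | hv'
  · exact huv.ne rfl
  · rcases hnr v hv' huv with rfl | rfl
    · exact hne (Or.inl rfl)
    · exact hne (Or.inr (Or.inr Sym2.eq_swap))
  · rcases hnr u hu' huv.symm with rfl | rfl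
    · exact hne (Or.inl Sym2.eq_swap)
    · exact hne (Or.inr (Or.inr rfl))
  · obtain ⟨u', hu'', rfl⟩ := hqT u hu'
    obtain ⟨v', hv'', rfl⟩ := hqT v hv'
    refine hne (Or.inr (Or.inl ?_))
    exact Walk.edges_map φ.toHom p ▸ List.mem_map.2 ⟨s(u', v'), hless.mem_edges hu'' hv'' huv, rfl⟩

/-- Dirac's theorem: every nonempty set of vertices of a chordal graph contains a vertex which is
simplicial in the induced subgraph. -/
theorem IsChordal.exists_simplicial (hΓ : Γ.IsChordal) (R : Finset V) (hR : R.Nonempty) :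
    ∃ v ∈ R, ∀ u ∈ R, ∀ w ∈ R, Γ.Adj u v → Γ.Adj w v → u ≠ w → Γ.Adj u w := by
  classical
  induction R using Finset.strongInduction with | _ R ih =>
  by_cases hclique : ∀ u ∈ R, ∀ w ∈ R, u ≠ w → Γ.Adj u w
  · obtain ⟨v, hv⟩ := hR
    exact ⟨v, hv, fun u hu w hw _ _ huw => hclique u hu w hw huw⟩
  push Not at hclique
  obtain ⟨a, ha, b, hb, hab, hnab⟩ := hclique
  -- Dirac's choice: a largest connected set `H` whose closed neighbourhood misses some vertex of
  -- `R`.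
  let 𝓗 : Finset (Finset V) := R.powerset.filter fun H =>
    (Γ.induce (H : Set V)).Connected ∧ ∃ r ∈ R, r ∉ H ∧ ∀ h ∈ H, ¬ Γ.Adj r h
  have h𝓗 : ({a} : Finset V) ∈ 𝓗 := by
    refine Finset.mem_filter.2 ⟨by simpa using ha, ?_, b, hb, by simpa using hab.symm, ?_⟩
    · rw [Finset.coe_singleton]
      exact ⟨Preconnected.of_subsingleton⟩
    · simpa using fun h => hnab (Γ.adj_symm h)
  obtain ⟨H, hH, hmax⟩ := Finset.exists_max_image 𝓗 Finset.card ⟨_, h𝓗⟩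
  obtain ⟨hHR, hHc, r, hrR, hrH, hr⟩ := Finset.mem_filter.1 hH
  rw [Finset.mem_powerset] at hHR
  -- By maximality, every boundary vertex of `H` is joined to every vertex away from `H`; otherwise
  -- it could be added to `H`.
  have hjoin (s : V) (hs : s ∈ R) (hsH : s ∉ H) (hsn : ∃ h ∈ H, Γ.Adj s h) (q : V) (hq : q ∈ R)
      (hqH : q ∉ H) (hqn : ∀ h ∈ H, ¬ Γ.Adj q h) : Γ.Adj q s := by
    by_contra hqs
    obtain ⟨h, hh, hsh⟩ := hsn
    have : insert s H ∈ 𝓗 := by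
      refine Finset.mem_filter.2 ⟨Finset.mem_powerset.2 (Finset.insert_subset hs hHR), ?_,
        q, hq, ?_, ?_⟩
      · have := induce_union_connected hHc.preconnected
          (induce_pair_connected_of_adj hsh).preconnected ⟨h, hh, by simp⟩
        convert this using 3 <;>
        · ext v
          simp only [Finset.coe_insert, Set.mem_insert_iff, Finset.mem_coe, Set.mem_union,
            Set.mem_singleton_iff]
          constructor
          · tauto
          · rintro (h | h | rfl) <;> tauto
      · rw [Finset.mem_insert, not_or]
        exact ⟨fun h' => hqn h hh (h' ▸ hsh), hqH⟩
      · intro v hv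
        rcases Finset.mem_insert.1 hv with rfl | hv
        · exact hqs
        · exact hqn v hv
    have := hmax _ this
    rw [Finset.card_insert_of_notMem hsH] at this
    omega
  let Q := R.filter fun q => q ∉ H ∧ ∀ h ∈ H, ¬ Γ.Adj q h
  obtain ⟨h0⟩ := hHc.nonempty
  have hQR : Q ⊂ R := Finset.filter_ssubset.2 ⟨h0, hHR h0.2, fun h => h.1 h0.2⟩
  -- A vertex simplicial in `Q` is simplicial in `R`: its neighbours lie in `Q` or on the boundary
  -- of `H`. Mixed pairs are adjacent by `hjoin`, boundary pairs by `adj_of_connected`.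
  obtain ⟨v, hvQ, hv⟩ := ih Q hQR ⟨r, Finset.mem_filter.2 ⟨hrR, hrH, hr⟩⟩
  obtain ⟨hvR, hvH, hvn⟩ := Finset.mem_filter.1 hvQ
  refine ⟨v, hvR, fun u hu w hw huv hwv huw => ?_⟩
  have hcase (u : V) (hu : u ∈ R) (huv : Γ.Adj u v) :
      u ∈ Q ∨ (u ∉ H ∧ ∃ h ∈ H, Γ.Adj u h) := by
    have huH : u ∉ H := fun h => hvn u h huv.symm
    by_cases h : ∃ h ∈ H, Γ.Adj u h
    · exact Or.inr ⟨huH, h⟩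
    · exact Or.inl (Finset.mem_filter.2 ⟨hu, huH, by simpa using h⟩)
  rcases hcase u hu huv with hu' | ⟨huH, hun⟩ <;> rcases hcase w hw hwv with hw' | ⟨hwH, hwn⟩
  · exact hv u hu' w hw' huv hwv huw
  · obtain ⟨-, h1, h2⟩ := Finset.mem_filter.1 hu'
    exact hjoin w hw hwH hwn u hu h1 h2
  · obtain ⟨-, h1, h2⟩ := Finset.mem_filter.1 hw'
    exact (hjoin u hu huH hun w hw h1 h2).symm
  · exact hΓ.adj_of_connected hHc huw hun hwn hvH hvn huv.symm hwv.symm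

/-- A *perfect elimination order*: the neighbours of a vertex which precede it form a clique. -/
def IsPerfectElimination (Γ : SimpleGraph V) (o : V → ℕ) : Prop :=
  ∀ u v w, Γ.Adj u v → Γ.Adj w v → o u < o v → o w < o v → u ≠ w → Γ.Adj u w

/-- A simplicial vertex is put last, with the value `S.card - 1`, and the rest is ordered by
induction. -/
theorem IsChordal.exists_perfectElimination [Fintype V] (hΓ : Γ.IsChordal) :
    ∃ o : V → ℕ, Function.Injective o ∧ (∀ v, o v < Fintype.card V) ∧
      Γ.IsPerfectElimination o := by
  classical
  have key (S : Finset V) : ∃ o : V → ℕ, Set.InjOn o S ∧ (∀ v ∈ S, o v < S.card) ∧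
      ∀ u ∈ S, ∀ v ∈ S, ∀ w ∈ S, Γ.Adj u v → Γ.Adj w v → o u < o v → o w < o v → u ≠ w →
        Γ.Adj u w := by
    induction S using Finset.strongInduction with | _ S ih =>
    rcases S.eq_empty_or_nonempty with rfl | hS
    · exact ⟨fun _ => 0, by simp, by simp, by simp⟩
    obtain ⟨z, hz, hsimp⟩ := hΓ.exists_simplicial S hS
    obtain ⟨o, hinj, hlt, ho⟩ := ih (S.erase z) (Finset.erase_ssubset hz)
    rw [Finset.card_erase_of_mem hz] at hlt
    have hpos := Finset.card_pos.2 hS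
    have hself : Function.update o z (S.card - 1) z = S.card - 1 := Function.update_self ..
    have hne {v : V} (hv : v ≠ z) : Function.update o z (S.card - 1) v = o v :=
      Function.update_of_ne hv ..
    have hlt' (v : V) (hv : v ∈ S) (hvz : v ≠ z) : o v < S.card - 1 :=
      hlt v (Finset.mem_erase.2 ⟨hvz, hv⟩)
    refine ⟨Function.update o z (S.card - 1), fun u hu v hv huv => ?_, fun v hv => ?_, ?_⟩
    · by_cases h1 : u = z <;> by_cases h2 : v = z
      · rw [h1, h2]
      · rw [h1, hself, hne h2] at huv
        exact absurd huv (hlt' v hv h2).ne'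
      · rw [h2, hself, hne h1] at huv
        exact absurd huv (hlt' u hu h1).ne
      · rw [hne h1, hne h2] at huv
        exact hinj (Finset.mem_erase.2 ⟨h1, hu⟩) (Finset.mem_erase.2 ⟨h2, hv⟩) huv
    · by_cases h1 : v = z
      · rw [h1, hself]; omega
      · rw [hne h1]; exact (hlt' v hv h1).trans_le (Nat.sub_le _ _)
    · intro u hu v hv w hw huv hwv h1 h2 huw
      by_cases hvz : v = z
      · subst hvz; exact hsimp u hu w hw huv hwv huw
      have hx (u : V) (hu : u ∈ S) (h1 : Function.update o z (S.card - 1) u < o v) :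
          u ≠ z ∧ o u < o v := by
        by_cases huz : u = z
        · rw [huz, hself] at h1
          exact absurd (hlt' v hv hvz) (by omega)
        · rw [hne huz] at h1
          exact ⟨huz, h1⟩
      rw [hne hvz] at h1 h2
      obtain ⟨hu1, hu2⟩ := hx u hu h1
      obtain ⟨hw1, hw2⟩ := hx w hw h2
      exact ho u (Finset.mem_erase.2 ⟨hu1, hu⟩) v (Finset.mem_erase.2 ⟨hvz, hv⟩) w
        (Finset.mem_erase.2 ⟨hw1, hw⟩) huv hwv hu2 hw2 huw
  obtain ⟨o, h1, h2, h3⟩ := key Finset.univ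
  exact ⟨o, by simpa using h1, by simpa using h2, fun u v w => h3 u (Finset.mem_univ u) v (Finset.mem_univ v) w (Finset.mem_univ w)⟩

end Chordal

end SimpleGraph

/-! ## The universal property of the model of a chordal graph -/

section AlternatingSum

variable {R : Type*} [Ring R]

/-- The alternating sum of the products of a list of ring elements with one factor omitted. -/
def alternatingSum : List R → R
  | [] => 0
  | a :: L => L.prod - a * alternatingSum L

theorem alternatingSum_eq_sum (L : List R) :
    alternatingSum L = ∑ j ∈ Finset.range L.length, (-1) ^ j * (L.eraseIdx j).prod := by
  induction L with
  | nil => rfl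
  | cons a L ih =>
    rw [alternatingSum, List.length_cons, Finset.sum_range_succ', ih, Finset.mul_sum, pow_zero,
      one_mul, List.eraseIdx_cons_zero, sub_eq_neg_add, ← Finset.sum_neg_distrib]
    congr 1
    refine Finset.sum_congr rfl fun j _ => ?_
    rw [List.eraseIdx_cons_succ, List.prod_cons, ← mul_assoc, ← mul_assoc, pow_succ, mul_neg_one,
      neg_mul, neg_mul, ((Commute.neg_one_left a).pow_left j).eq]

/-- The recursion for the alternating sum involves the product of the tail, so both must be followed
with a common sign. This makes the relations independent of the order of the edges. -/
theorem alternatingSum_perm {L L' : List R} (h : L.Perm L')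
    (hL : ∀ a ∈ L, ∀ b ∈ L, a * b = -(b * a)) :
    (L'.prod = L.prod ∧ alternatingSum L' = alternatingSum L) ∨
      (L'.prod = -L.prod ∧ alternatingSum L' = -alternatingSum L) := by
  induction h with
  | nil => simp
  | cons a _ ih =>
    rcases ih fun b hb c hc => hL b (List.mem_cons_of_mem _ hb) c (List.mem_cons_of_mem _ hc) with
      ⟨h1, h2⟩ | ⟨h1, h2⟩
    · exact Or.inl ⟨by rw [List.prod_cons, List.prod_cons, h1],
        by rw [alternatingSum, alternatingSum, h1, h2]⟩
    · exact Or.inr ⟨by rw [List.prod_cons, List.prod_cons, h1, mul_neg],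
        by rw [alternatingSum, alternatingSum, h1, h2]; noncomm_ring⟩
  | swap a b L =>
    have hab := hL b (by simp) a (by simp)
    refine Or.inr ⟨?_, ?_⟩
    · simp only [List.prod_cons, ← mul_assoc, hab]; noncomm_ring
    · simp only [alternatingSum, List.prod_cons, mul_sub, ← mul_assoc, hab]; noncomm_ring
  | trans h1 _ ih1 ih2 =>
    have ih2 := ih2 fun a ha b hb => hL a (h1.mem_iff.2 ha) b (h1.mem_iff.2 hb)
    rcases ih1 hL with ⟨e1, e2⟩ | ⟨e1, e2⟩ <;> rcases ih2 with ⟨e3, e4⟩ | ⟨e3, e4⟩ <;>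
      simp [e1, e2, e3, e4]

theorem alternatingSum_eq_zero_of_perm {L L' : List R} (h : L.Perm L')
    (hL : ∀ a ∈ L, ∀ b ∈ L, a * b = -(b * a)) (h0 : alternatingSum L = 0) :
    alternatingSum L' = 0 := by
  rcases alternatingSum_perm h hL with ⟨-, h⟩ | ⟨-, h⟩ <;> simp [h, h0]

theorem mul_self_eq_zero_of_eq_neg [Algebra ℚ R] {a : R} (h : a * a = -(a * a)) : a * a = 0 := by
  have h2 : (2 : ℚ) • (a * a) = 0 := by
    rw [two_smul]
    exact add_eq_zero_iff_eq_neg.2 h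
  exact (smul_eq_zero.1 h2).resolve_left two_ne_zero

end AlternatingSum

namespace SimpleGraph

variable {V : Type*} (Γ : SimpleGraph V)

/-- The relations of the model of a chordal graph in a ring: the elements `x u`, `y u`, `g u w`
anticommute and satisfy the relations attached to the edges and triangles of the graph. -/
structure IsModelSystem {R : Type*} [Ring R] (x y : V → R) (g : V → V → R) : Prop where
  anticomm : ∀ a ∈ Set.range x ∪ Set.range y ∪ Set.range (Function.uncurry g),
    ∀ b ∈ Set.range x ∪ Set.range y ∪ Set.range (Function.uncurry g), a * b = -(b * a)
  g_symm : ∀ u w, g u w = g w u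
  g_of_not_adj : ∀ u w, ¬ Γ.Adj u w → g u w = 0
  x_sub_mul_g : ∀ u w, (x u - x w) * g u w = 0
  y_sub_mul_g : ∀ u w, (y u - y w) * g u w = 0
  triangle : ∀ u v w, Γ.Adj u v → Γ.Adj w v → Γ.Adj u w →
    g u v * g w v = g u w * (g w v - g u v)

namespace IsModelSystem

variable {Γ} {R : Type*} [Ring R] {x y : V → R} {g : V → V → R}

theorem g_mul_g (h : Γ.IsModelSystem x y g) (u v u' v' : V) : g u v * g u' v' = -(g u' v' * g u v) :=
  h.anticomm _ (Or.inr ⟨(u, v), rfl⟩) _ (Or.inr ⟨(u', v'), rfl⟩)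

theorem x_mul_g (h : Γ.IsModelSystem x y g) (u u' v' : V) : x u * g u' v' = -(g u' v' * x u) :=
  h.anticomm _ (Or.inl (Or.inl ⟨u, rfl⟩)) _ (Or.inr ⟨(u', v'), rfl⟩)

theorem y_mul_g (h : Γ.IsModelSystem x y g) (u u' v' : V) : y u * g u' v' = -(g u' v' * y u) :=
  h.anticomm _ (Or.inl (Or.inr ⟨u, rfl⟩)) _ (Or.inr ⟨(u', v'), rfl⟩)

theorem x_mul_x (h : Γ.IsModelSystem x y g) (u v : V) : x u * x v = -(x v * x u) :=
  h.anticomm _ (Or.inl (Or.inl ⟨u, rfl⟩)) _ (Or.inl (Or.inl ⟨v, rfl⟩))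

theorem x_mul_y (h : Γ.IsModelSystem x y g) (u v : V) : x u * y v = -(y v * x u) :=
  h.anticomm _ (Or.inl (Or.inl ⟨u, rfl⟩)) _ (Or.inl (Or.inr ⟨v, rfl⟩))

theorem y_mul_y (h : Γ.IsModelSystem x y g) (u v : V) : y u * y v = -(y v * y u) :=
  h.anticomm _ (Or.inl (Or.inr ⟨u, rfl⟩)) _ (Or.inl (Or.inr ⟨v, rfl⟩))

/-- The Orlik–Solomon relation holds for every closed walk in a graph with a perfect elimination
order. -/
theorem alternatingSum_closedWalk [Algebra ℚ R] (h : Γ.IsModelSystem x y g) {o : V → ℕ}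
    (ho : Function.Injective o) (hΓ : Γ.IsPerfectElimination o) (n : ℕ) (u : V) (c : Γ.Walk u u)
    (hn : c.length = n) : alternatingSum (c.darts.map fun d => g d.fst d.snd) = 0 := by
  classical
  -- Closed walks rather than cycles are used so that shortcuts stay in the class without any check
  -- of simplicity.
  induction n using Nat.strongRecOn generalizing u with | _ n ih =>
  obtain ⟨m, hm, hmax⟩ := Finset.exists_max_image c.support.toFinset o ⟨u, by simp⟩
  rw [List.mem_toFinset] at hm
  have hanti (L : List Γ.Dart) : ∀ a ∈ L.map (fun d => g d.fst d.snd),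
      ∀ b ∈ L.map (fun d => g d.fst d.snd), a * b = -(b * a) := by
    intro a ha b hb
    obtain ⟨d, -, rfl⟩ := List.mem_map.1 ha
    obtain ⟨d', -, rfl⟩ := List.mem_map.1 hb
    exact h.g_mul_g _ _ _ _
  refine alternatingSum_eq_zero_of_perm ((c.rotate_darts m hm).perm.map _) (hanti _) ?_
  have hsupp (v : V) (hv : v ∈ (c.rotate m hm).support) : o v ≤ o m :=
    hmax v (List.mem_toFinset.2 ((c.mem_support_rotate_iff m hm).1 hv))
  have hlen : (c.rotate m hm).length = n := by
    rw [← hn, ← Walk.length_darts, ← Walk.length_darts, (c.rotate_darts m hm).perm.length_eq]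
  generalize c.rotate m hm = c' at hsupp hlen
  cases c' with
  | nil => rfl
  | @cons _ a _ hma p =>
  cases p with
  | nil => exact absurd rfl hma.ne
  | @cons _ a' _ haa' p' =>
  obtain ⟨b, q, hbm, hq⟩ := Walk.exists_cons_eq_concat haa' p'
  rw [hq] at hsupp hlen ⊢
  rw [Walk.length_cons, Walk.length_concat] at hlen
  have hlt (v : V) (hv : v ∈ (Walk.cons hma (q.concat hbm)).support) (hne : v ≠ m) : o v < o m :=
    lt_of_le_of_ne (hsupp v hv) fun h' => hne (ho h')
  refine alternatingSum_eq_zero_of_perm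
    (L := ((⟨(b, m), hbm⟩ : Γ.Dart) :: ⟨(m, a), hma⟩ :: q.darts).map fun d => g d.fst d.snd)
    (List.Perm.map _ ?_) (hanti _) ?_
  · rw [Walk.darts_cons, Walk.darts_concat, List.concat_eq_append]
    exact (List.perm_append_comm (l₁ := [_]))
  simp only [List.map_cons, alternatingSum, List.prod_cons]
  rw [h.g_symm m a]
  by_cases hab : a = b
  · subst hab
    rw [mul_sub, ← mul_assoc (g _ _) (g _ _),
      mul_self_eq_zero_of_eq_neg (h.g_mul_g _ _ _ _), zero_mul, sub_zero, sub_self]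
  -- The two neighbours of the `o`-last vertex `m` on the walk precede it, hence are adjacent, and
  -- `m` can be bypassed.
  · have hba : Γ.Adj b a := hΓ b m a hbm hma.symm
      (hlt b (by simp [Walk.support_concat]) hbm.ne)
      (hlt a (by simp [Walk.support_concat]) hma.symm.ne) (Ne.symm hab)
    have h0 := ih (q.length + 1) (by omega) b (.cons hba q) (Walk.length_cons ..)
    rw [Walk.darts_cons, List.map_cons, alternatingSum] at h0
    have ht := h.triangle b m a hbm hma.symm hba
    have e1 := h.g_mul_g b a a m
    have e2 := h.g_mul_g b a b m
    set D := alternatingSum (q.darts.map fun d => g d.fst d.snd)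
    set P := (q.darts.map fun d => g d.fst d.snd).prod
    -- The triangle relation splits off a left factor; the other factor is the alternating sum of
    -- the shortened walk.
    have : g a m * P - g b m * (P - g a m * D) = (g a m - g b m) * (P - g b a * D) := by
      rw [mul_sub (g b m), ← mul_assoc, ht, mul_sub (g b a), e1, e2]
      noncomm_ring
    rw [this]
    change _ * (P - g b a * D) = 0
    rw [h0, mul_zero]

end IsModelSystem

end SimpleGraph

namespace SimpleGraph

variable {V : Type*}

/-- Anticommutation is bilinear, unlike vanishing of squares; it passes to linear combinations, and
division by two then gives the square-zero condition for lifting to the exterior algebra. -/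
theorem linearCombination_mul_self {S R : Type*} [Ring R] [Algebra ℚ R] (z : S → R)
    (hz : ∀ a b, z a * z b = -(z b * z a)) (f : S →₀ ℚ) :
    Finsupp.linearCombination ℚ z f * Finsupp.linearCombination ℚ z f = 0 := by
  have key (f f' : S →₀ ℚ) : Finsupp.linearCombination ℚ z f * Finsupp.linearCombination ℚ z f' =
      -(Finsupp.linearCombination ℚ z f' * Finsupp.linearCombination ℚ z f) := by
    induction f using Finsupp.induction_linear with
    | zero => simp
    | add f1 f2 h1 h2 => rw [map_add, add_mul, mul_add, h1, h2, neg_add]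
    | single a r =>
      induction f' using Finsupp.induction_linear with
      | zero => simp
      | add f1 f2 h1 h2 => rw [map_add, add_mul, mul_add, h1, h2, neg_add]
      | single b s =>
        simp only [Finsupp.linearCombination_single, smul_mul_assoc, mul_smul_comm]
        rw [hz, smul_neg, smul_neg, smul_comm]
  exact mul_self_eq_zero_of_eq_neg (key f f)

section Universal

variable [LinearOrder V] {Γ : SimpleGraph V}

theorem boundary_eq_neg_alternatingSum {V : Type*} {Γ : SimpleGraph V} (l : List Γ.edgeSet) :
    boundary Γ l = -alternatingSum (l.map fun e => modelGen Γ (.g e)) := by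
  rw [alternatingSum_eq_sum, boundary, List.length_map, ← Finset.sum_neg_distrib]
  refine Finset.sum_congr rfl fun j _ => ?_
  rw [← List.eraseIdx_map, pow_succ, mul_neg_one, neg_mul]

theorem map_alternatingSum {R S : Type*} [Ring R] [Ring S] (φ : R →+* S) (L : List R) :
    φ (alternatingSum L) = alternatingSum (L.map φ) := by
  induction L with
  | nil => exact map_zero φ
  | cons a L ih =>
    rw [List.map_cons, alternatingSum, alternatingSum, map_sub, map_mul, ih, map_list_prod]

/-- The universal property of the model of a graph with a perfect elimination order. -/
theorem IsModelSystem.exists_algHom {R : Type*} [Ring R] [Algebra ℚ R] {x y : V → R}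
    {g : V → V → R} (h : Γ.IsModelSystem x y g) {o : V → ℕ} (ho : Function.Injective o)
    (hΓ : Γ.IsPerfectElimination o) :
    ∃ φ : AbelianModel Γ →ₐ[ℚ] R,
      (∀ v, φ (AbelianModel.mk Γ (modelGen Γ (.x v))) = x v) ∧
      (∀ v, φ (AbelianModel.mk Γ (modelGen Γ (.y v))) = y v) ∧
      ∀ u w (huw : Γ.Adj u w), φ (AbelianModel.mk Γ (modelGen Γ (.g ⟨s(u, w), huw⟩))) = g u w := by
  let gs : Sym2 V → R := Sym2.lift ⟨g, h.g_symm⟩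
  let z : ModelGen Γ → R := fun a => match a with
    | .x v => x v
    | .y v => y v
    | .g e => gs e
  have hz_mem (a : ModelGen Γ) :
      z a ∈ Set.range x ∪ Set.range y ∪ Set.range (Function.uncurry g) := by
    rcases a with v | v | ⟨e, he⟩
    · exact Or.inl (Or.inl ⟨v, rfl⟩)
    · exact Or.inl (Or.inr ⟨v, rfl⟩)
    · induction e with | _ u w => exact Or.inr ⟨(u, w), rfl⟩
  let ψ : ModelExterior Γ →ₐ[ℚ] R := ExteriorAlgebra.lift ℚ
    ⟨Finsupp.linearCombination ℚ z, linearCombination_mul_self z fun a b =>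
      h.anticomm _ (hz_mem a) _ (hz_mem b)⟩
  have hψ (a : ModelGen Γ) : ψ (modelGen Γ a) = z a := by
    rw [modelGen, ExteriorAlgebra.lift_ι_apply, Finsupp.linearCombination_single, one_smul]
  have hrel : ∀ ⦃a b⦄, ModelRel Γ a b → ψ a = ψ b := by
    intro a b hab
    cases hab with
    | cycle l hl =>
      obtain ⟨hsort, v, c, hc, hmem⟩ := hl
      have hnd : l.Nodup := hsort.imp fun {e e'} hlt => by
        rintro rfl
        exact lt_irrefl _ hlt
      have hperm : c.edges.Perm (l.map Subtype.val) := by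
        refine (List.perm_ext_iff_of_nodup hc.isTrail.edges_nodup
          (hnd.map Subtype.val_injective)).2 fun e => ?_
        rw [List.mem_map]
        constructor
        · exact fun he => ⟨⟨e, c.edges_subset_edgeSet he⟩, (hmem _).2 he, rfl⟩
        · rintro ⟨e, he, rfl⟩
          exact (hmem e).1 he
      have h0 := h.alternatingSum_closedWalk ho hΓ _ v c rfl
      have hmap : (c.darts.map fun d => g d.fst d.snd) = c.edges.map gs := by
        rw [Walk.edges, List.map_map]
        rfl
      have h1 : alternatingSum ((l.map Subtype.val).map gs) = 0 := by
        refine alternatingSum_eq_zero_of_perm (hperm.map gs) ?_ (hmap ▸ h0)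
        rw [← hmap]
        intro a ha b hb
        obtain ⟨d, -, rfl⟩ := List.mem_map.1 ha
        obtain ⟨d', -, rfl⟩ := List.mem_map.1 hb
        exact h.g_mul_g _ _ _ _
      rw [boundary_eq_neg_alternatingSum, map_neg, map_zero, neg_eq_zero, ← h1]
      refine (map_alternatingSum ψ.toRingHom _).trans ?_
      rw [List.map_map, List.map_map]
      congr 1
      exact List.map_congr_left fun e _ => hψ _
    | x e =>
      rw [map_mul, map_sub, hψ, hψ, hψ, map_zero]
      obtain ⟨e, he⟩ := e
      induction e with | _ u w =>
      change (x (u ⊔ w) - x (u ⊓ w)) * g u w = 0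
      rcases le_total u w with huw | huw
      · rw [sup_eq_right.2 huw, inf_eq_left.2 huw, h.g_symm, h.x_sub_mul_g]
      · rw [sup_eq_left.2 huw, inf_eq_right.2 huw, h.x_sub_mul_g]
    | y e =>
      rw [map_mul, map_sub, hψ, hψ, hψ, map_zero]
      obtain ⟨e, he⟩ := e
      induction e with | _ u w =>
      change (y (u ⊔ w) - y (u ⊓ w)) * g u w = 0
      rcases le_total u w with huw | huw
      · rw [sup_eq_right.2 huw, inf_eq_left.2 huw, h.g_symm, h.y_sub_mul_g]
      · rw [sup_eq_left.2 huw, inf_eq_right.2 huw, h.y_sub_mul_g]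
  refine ⟨RingQuot.liftAlgHom ℚ ⟨ψ, hrel⟩, fun v => ?_, fun v => ?_, fun u w huw => ?_⟩
  · rw [RingQuot.liftAlgHom_mkAlgHom_apply, hψ]
  · rw [RingQuot.liftAlgHom_mkAlgHom_apply, hψ]
  · rw [RingQuot.liftAlgHom_mkAlgHom_apply, hψ]
    rfl

end Universal

/-! ### Relations between the generators of the model. -/

namespace AbelianModel

variable [LinearOrder V] (Γ : SimpleGraph V)

/-- The generator `x_v` of the model. -/
noncomputable def x (v : V) : AbelianModel Γ := mk Γ (modelGen Γ (.x v))

/-- The generator `y_v` of the model. -/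
noncomputable def y (v : V) : AbelianModel Γ := mk Γ (modelGen Γ (.y v))

open Classical in
/-- The generator `g_e`, `e = {u, w}`, of the model, or zero if `u` and `w` are not adjacent. -/
noncomputable def g (u w : V) : AbelianModel Γ :=
  if h : Γ.Adj u w then mk Γ (modelGen Γ (.g ⟨s(u, w), h⟩)) else 0

variable {Γ}

theorem g_of_adj {u w : V} (h : Γ.Adj u w) : g Γ u w = mk Γ (modelGen Γ (.g ⟨s(u, w), h⟩)) :=
  dif_pos h

theorem g_comm (u w : V) : g Γ u w = g Γ w u := by
  by_cases h : Γ.Adj u w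
  · rw [g_of_adj h, g_of_adj h.symm]
    congr 3
    exact Subtype.ext Sym2.eq_swap
  · rw [g, g, dif_neg h, dif_neg fun h' => h h'.symm]

theorem mk_modelGen_mul (a b : ModelGen Γ) :
    mk Γ (modelGen Γ a) * mk Γ (modelGen Γ b) = -(mk Γ (modelGen Γ b) * mk Γ (modelGen Γ a)) := by
  rw [← map_mul, ← map_mul, ← map_neg]
  congr 1
  exact eq_neg_of_add_eq_zero_left (ExteriorAlgebra.ι_add_mul_swap _ _)

theorem sub_mul_g_eq_zero (a : V → ModelGen Γ) (ha : ∀ e, mk Γ ((modelGen Γ (a (Γ.head e)) -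
    modelGen Γ (a (Γ.tail e))) * modelGen Γ (.g e)) = 0) (u w : V) :
    (mk Γ (modelGen Γ (a u)) - mk Γ (modelGen Γ (a w))) * g Γ u w = 0 := by
  by_cases h : Γ.Adj u w
  · rw [g_of_adj h, ← map_sub, ← map_mul]
    have := ha ⟨s(u, w), h⟩
    rcases le_total u w with huw | huw
    · rw [head, tail, Sym2.sup_mk, Sym2.inf_mk, sup_eq_right.2 huw, inf_eq_left.2 huw] at this
      rw [← neg_sub, neg_mul, map_neg, this, neg_zero]
    · rwa [head, tail, Sym2.sup_mk, Sym2.inf_mk, sup_eq_left.2 huw, inf_eq_right.2 huw] at this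
  · rw [g, dif_neg h, mul_zero]

/-- The generators for the edges of a cycle, in any order, satisfy the Orlik–Solomon relation. -/
theorem alternatingSum_eq_zero {v : V} (c : Γ.Walk v v) (hc : c.IsCycle) (l : List Γ.edgeSet)
    (hnd : l.Nodup) (hl : ∀ e : Γ.edgeSet, e ∈ l ↔ (e : Sym2 V) ∈ c.edges) :
    alternatingSum (l.map fun e => mk Γ (modelGen Γ (.g e))) = 0 := by
  let key : Γ.edgeSet → V ×ₗ V := fun e => toLex (Γ.head e, Γ.tail e)
  have hkey : Function.Injective key := fun e e' h => by
    have h := toLex.injective h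
    exact Subtype.ext (Sym2.inf_eq_inf_and_sup_eq_sup.1 ⟨(Prod.ext_iff.1 h).2, (Prod.ext_iff.1 h).1⟩)
  let r : Γ.edgeSet → Γ.edgeSet → Prop := fun e e' => key e ≤ key e'
  have : Std.Total r := ⟨fun e e' => le_total (key e) (key e')⟩
  have : IsTrans Γ.edgeSet r := ⟨fun _ _ _ => le_trans⟩
  have hperm := List.perm_insertionSort r l
  have hnd' : (l.insertionSort r).Nodup := hperm.nodup_iff.2 hnd
  have hord : IsOrderedCycle Γ (l.insertionSort r) := by
    refine ⟨((List.pairwise_insertionSort r l).and hnd').imp fun {e e'} h =>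
      lt_of_le_of_ne h.1 fun h' => h.2 (hkey h'), v, c, hc, fun e => ?_⟩
    rw [hperm.mem_iff, hl]
  have h0 : mk Γ (boundary Γ (l.insertionSort r)) = 0 :=
    (RingQuot.mkAlgHom_rel ℚ (ModelRel.cycle _ hord)).trans (map_zero _)
  rw [boundary_eq_neg_alternatingSum, map_neg, neg_eq_zero] at h0
  refine alternatingSum_eq_zero_of_perm (hperm.map _) ?_ ?_
  · intro a ha b hb
    obtain ⟨e, -, rfl⟩ := List.mem_map.1 ha
    obtain ⟨e', -, rfl⟩ := List.mem_map.1 hb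
    exact mk_modelGen_mul _ _
  · rw [← h0]
    refine Eq.trans ?_ (map_alternatingSum (mk Γ).toRingHom _).symm
    rw [List.map_map]
    rfl

variable (Γ)

theorem isModelSystem : Γ.IsModelSystem (x Γ) (y Γ) (g Γ) where
  anticomm := by
    have key : ∀ a ∈ Set.range (x Γ) ∪ Set.range (y Γ) ∪ Set.range (Function.uncurry (g Γ)),
        a = 0 ∨ ∃ b, a = mk Γ (modelGen Γ b) := by
      rintro _ ((⟨v, rfl⟩ | ⟨v, rfl⟩) | ⟨⟨u, w⟩, rfl⟩)
      · exact Or.inr ⟨_, rfl⟩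
      · exact Or.inr ⟨_, rfl⟩
      · by_cases h : Γ.Adj u w
        · exact Or.inr ⟨_, g_of_adj h⟩
        · exact Or.inl (dif_neg h)
    intro a ha b hb
    rcases key a ha with rfl | ⟨a, rfl⟩
    · simp
    rcases key b hb with rfl | ⟨b, rfl⟩
    · simp
    exact mk_modelGen_mul a b
  g_symm := g_comm
  g_of_not_adj u w h := dif_neg h
  x_sub_mul_g := sub_mul_g_eq_zero _ fun e =>
    (RingQuot.mkAlgHom_rel ℚ (ModelRel.x e)).trans (map_zero _)
  y_sub_mul_g := sub_mul_g_eq_zero _ fun e =>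
    (RingQuot.mkAlgHom_rel ℚ (ModelRel.y e)).trans (map_zero _)
  triangle u v w huv hwv huw := by
    let c : Γ.Walk u u := .cons huw (.cons hwv (.cons huv.symm .nil))
    have hc : c.IsCycle := by
      rw [Walk.cons_isCycle_iff]
      simp [huv.ne, hwv.ne, huw.ne, huv.ne', huw.ne']
    have := alternatingSum_eq_zero c hc
      [⟨s(u, w), huw⟩, ⟨s(u, v), huv⟩, ⟨s(w, v), hwv⟩]
      (by simp [Subtype.ext_iff, huv.ne, hwv.ne, huw.ne, hwv.ne', huw.ne'])
      (fun e => by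
        simp only [List.mem_cons, Subtype.ext_iff, List.not_mem_nil, or_false, c, Walk.edges_cons,
          Walk.edges_nil, Sym2.eq_swap (a := v) (b := u)]
        tauto)
    simp only [List.map_cons, List.map_nil, alternatingSum, List.prod_cons, List.prod_nil, mul_one,
      mul_zero, sub_zero, ← g_of_adj] at this
    exact sub_eq_zero.1 this

end AbelianModel

end SimpleGraph

/-! ## A representation of the model of the expected dimension -/

namespace SimpleGraph

namespace ConeModule

variable {V : Type*} {M : Type*} [AddCommGroup M] [Module ℚ M] (x y : V → Module.End ℚ M)
  (g : V → V → Module.End ℚ M) (U : Finset V)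

/-- The underlying space of the module obtained by adjoining a vertex with neighbours `U`: the
direct sum of the copies of `M` attached to the monomials `1`, `x_v`, `y_v`, `x_v y_v` and
`g_{uv}`, `u ∈ U`. -/
abbrev Space (M : Type*) (U : Finset V) := M × M × M × M × (U → M)

/-- The action of an element of odd degree on `M`, extended to the cone. -/
def extend (b : Module.End ℚ M) : Module.End ℚ (Space M U) where
  -- The tuple `p` stands for `p₁ + x_v p₂ + y_v p₃ + x_v y_v p₄ + ∑ g_{wv} p₅(w)`; the signs come
  -- from moving the odd `b` past these monomials.
  toFun p := (b p.1, -b p.2.1, -b p.2.2.1, b p.2.2.2.1, fun w => -b (p.2.2.2.2 w))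
  map_add' p q := by
    ext <;> simp only [Prod.fst_add, Prod.snd_add, Pi.add_apply, map_add, neg_add]
  map_smul' c p := by
    ext <;> simp only [Prod.smul_fst, Prod.smul_snd, Pi.smul_apply, map_smul, smul_neg,
      RingHom.id_apply]

/-- The action of `x_v`. -/
def actX : Module.End ℚ (Space M U) where
  -- On the last summand, `x_v g_{wv} = x_w g_{wv} = -g_{wv} x_w`.
  toFun p := (0, p.1, 0, p.2.2.1, fun w => -x w (p.2.2.2.2 w))
  map_add' p q := by
    ext <;> simp only [Prod.fst_add, Prod.snd_add, Pi.add_apply, map_add, neg_add, add_zero]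
  map_smul' c p := by
    ext <;> simp only [Prod.smul_fst, Prod.smul_snd, Pi.smul_apply, map_smul, smul_neg,
      RingHom.id_apply, smul_zero]

/-- The action of `y_v`. -/
def actY : Module.End ℚ (Space M U) where
  toFun p := (0, 0, p.1, -p.2.1, fun w => -y w (p.2.2.2.2 w))
  map_add' p q := by
    ext <;> simp only [Prod.fst_add, Prod.snd_add, Pi.add_apply, map_add, neg_add, add_zero]
  map_smul' c p := by
    ext <;> simp only [Prod.smul_fst, Prod.smul_snd, Pi.smul_apply, map_smul, smul_neg,
      RingHom.id_apply, smul_zero]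

/-- The leading coefficient of `g_{uv} p`. -/
def coeff (u : V) : Space M U →ₗ[ℚ] M where
  -- After `g_{uv}`, the elements `x_v`, `y_v` may be replaced by `x_u`, `y_u`, and `g_{uv} g_{wv} =
  -- g_{uv} g_{uw} - g_{wv} g_{uw}` by the triangle relation; the last term is the correction in
  -- `actG`.
  toFun p := p.1 + x u p.2.1 + y u p.2.2.1 + x u (y u p.2.2.2.1) + ∑ w : U, g u w (p.2.2.2.2 w)
  map_add' p q := by
    simp only [Prod.fst_add, Prod.snd_add, Pi.add_apply, map_add, Finset.sum_add_distrib]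
    abel
  map_smul' c p := by
    simp only [Prod.smul_fst, Prod.smul_snd, Pi.smul_apply, map_smul, smul_add, Finset.smul_sum,
      RingHom.id_apply]

open Classical in
/-- The action of `g_{uv}`. -/
noncomputable def actG (u : V) : Module.End ℚ (Space M U) where
  toFun p := (0, 0, 0, 0, fun w =>
    (if (w : V) = u then coeff x y g U u p else 0) - g u w (p.2.2.2.2 w))
  map_add' p q := by
    ext w
    · simp
    · simp
    · simp
    · simp
    · simp only [Prod.snd_add, Pi.add_apply, map_add]
      split_ifs <;> abel
  map_smul' c p := by
    ext w
    · simp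
    · simp
    · simp
    · simp
    · simp only [Prod.smul_snd, Pi.smul_apply, map_smul, RingHom.id_apply, smul_sub]
      split_ifs <;> simp

variable {x y g U}

theorem extend_apply (b : Module.End ℚ M) (p : Space M U) : extend U b p =
    (b p.1, -b p.2.1, -b p.2.2.1, b p.2.2.2.1, fun w => -b (p.2.2.2.2 w)) := rfl

theorem actX_apply (p : Space M U) :
    actX x U p = (0, p.1, 0, p.2.2.1, fun w : U => -x w (p.2.2.2.2 w)) := rfl

theorem actY_apply (p : Space M U) :
    actY y U p = (0, 0, p.1, -p.2.1, fun w : U => -y w (p.2.2.2.2 w)) := rfl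

theorem coeff_apply (u : V) (p : Space M U) : coeff x y g U u p =
    p.1 + x u p.2.1 + y u p.2.2.1 + x u (y u p.2.2.2.1) + ∑ w : U, g u w (p.2.2.2.2 w) := rfl

open Classical in
theorem actG_apply (u : V) (p : Space M U) : actG x y g U u p = (0, 0, 0, 0, fun w : U =>
    (if (w : V) = u then coeff x y g U u p else 0) - g u w (p.2.2.2.2 w)) := rfl

theorem extend_mul_extend {a b : Module.End ℚ M} (h : a * b = -(b * a)) :
    extend U a * extend U b = -(extend U b * extend U a) := by
  have h' (m : M) : a (b m) = -b (a m) := LinearMap.congr_fun h m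
  refine LinearMap.ext fun p => ?_
  simp [extend_apply, h', Prod.ext_iff, funext_iff]

theorem extend_mul_eq_zero {a b : Module.End ℚ M} (h : a * b = 0) :
    extend U a * extend U b = 0 := by
  have h' (m : M) : a (b m) = 0 := LinearMap.congr_fun h m
  refine LinearMap.ext fun p => ?_
  simp [extend_apply, h', Prod.ext_iff, funext_iff]

theorem extend_zero : extend U (0 : Module.End ℚ M) = 0 := by
  refine LinearMap.ext fun p => ?_
  simp [extend_apply, Prod.ext_iff, funext_iff]

theorem extend_sub (a b : Module.End ℚ M) : extend U (a - b) = extend U a - extend U b := by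
  refine LinearMap.ext fun p => ?_
  simp [extend_apply, Prod.ext_iff, funext_iff, sub_eq_add_neg, add_comm]

theorem extend_mul_extend_eq {a b c d : Module.End ℚ M} (h : a * b = c * d) :
    extend U a * extend U b = extend U c * extend U d := by
  have h' (m : M) : a (b m) = c (d m) := LinearMap.congr_fun h m
  refine LinearMap.ext fun p => ?_
  simp [extend_apply, h']

theorem extend_mul_actX {b : Module.End ℚ M} (h : ∀ w, x w * b = -(b * x w)) :
    extend U b * actX x U = -(actX x U * extend U b) := by
  have h' (w : V) (m : M) : x w (b m) = -b (x w m) := LinearMap.congr_fun (h w) m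
  refine LinearMap.ext fun p => ?_
  simp [extend_apply, actX_apply, h', Prod.ext_iff, funext_iff]

theorem extend_mul_actY {b : Module.End ℚ M} (h : ∀ w, y w * b = -(b * y w)) :
    extend U b * actY y U = -(actY y U * extend U b) := by
  have h' (w : V) (m : M) : y w (b m) = -b (y w m) := LinearMap.congr_fun (h w) m
  refine LinearMap.ext fun p => ?_
  simp [extend_apply, actY_apply, h', Prod.ext_iff, funext_iff]

theorem coeff_extend {b : Module.End ℚ M} (hx : ∀ w, x w * b = -(b * x w))
    (hy : ∀ w, y w * b = -(b * y w)) (hg : ∀ u w, g u w * b = -(b * g u w)) (u : V)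
    (p : Space M U) : coeff x y g U u (extend U b p) = b (coeff x y g U u p) := by
  have hx' (w : V) (m : M) : x w (b m) = -b (x w m) := LinearMap.congr_fun (hx w) m
  have hy' (w : V) (m : M) : y w (b m) = -b (y w m) := LinearMap.congr_fun (hy w) m
  have hg' (u w : V) (m : M) : g u w (b m) = -b (g u w m) := LinearMap.congr_fun (hg u w) m
  simp [coeff_apply, extend_apply, hx', hy', hg']

theorem extend_mul_actG {b : Module.End ℚ M} (hx : ∀ w, x w * b = -(b * x w))
    (hy : ∀ w, y w * b = -(b * y w)) (hg : ∀ u w, g u w * b = -(b * g u w)) (u : V) :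
    extend U b * actG x y g U u = -(actG x y g U u * extend U b) := by
  have hg' (u w : V) (m : M) : g u w (b m) = -b (g u w m) := LinearMap.congr_fun (hg u w) m
  refine LinearMap.ext fun p => ?_
  rw [Module.End.mul_apply, LinearMap.neg_apply, Module.End.mul_apply, actG_apply u (extend U b p),
    coeff_extend hx hy hg, extend_apply, extend_apply, actG_apply]
  simp only [Prod.ext_iff, funext_iff, Prod.fst_neg, Prod.snd_neg, Pi.neg_apply, neg_zero, map_sub,
    map_neg, hg', map_zero, true_and]
  intro w
  split_ifs
  · abel
  · rw [map_zero]; abel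

theorem actX_mul_actX (h : ∀ w, x w * x w = 0) : actX x U * actX x U = 0 := by
  have h' (w : V) (m : M) : x w (x w m) = 0 := LinearMap.congr_fun (h w) m
  refine LinearMap.ext fun p => ?_
  simp [actX_apply, h', Prod.ext_iff, funext_iff]

theorem actY_mul_actY (h : ∀ w, y w * y w = 0) : actY y U * actY y U = 0 := by
  have h' (w : V) (m : M) : y w (y w m) = 0 := LinearMap.congr_fun (h w) m
  refine LinearMap.ext fun p => ?_
  simp [actY_apply, h', Prod.ext_iff, funext_iff]

theorem actX_mul_actY (h : ∀ w, x w * y w = -(y w * x w)) :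
    actX x U * actY y U = -(actY y U * actX x U) := by
  have h' (w : V) (m : M) : x w (y w m) = -y w (x w m) := LinearMap.congr_fun (h w) m
  refine LinearMap.ext fun p => ?_
  simp [actX_apply, actY_apply, h', Prod.ext_iff, funext_iff]

theorem actX_mul_actG (hxx' : ∀ u, x u * x u = 0) (hxg : ∀ u w, x u * g u w = x w * g u w)
    (hxg' : ∀ u v w, x u * g v w = -(g v w * x u)) (u : V) :
    actX x U * actG x y g U u = -(actG x y g U u * actX x U) := by
  have h1 (u : V) (m : M) : x u (x u m) = 0 := LinearMap.congr_fun (hxx' u) m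
  have h2 (u w : V) (m : M) : x u (g u w m) = x w (g u w m) := LinearMap.congr_fun (hxg u w) m
  have h3 (u v w : V) (m : M) : g v w (x u m) = -x u (g v w m) := by
    rw [eq_comm, neg_eq_iff_eq_neg]; exact LinearMap.congr_fun (hxg' u v w) m
  have hc (p : Space M U) : coeff x y g U u (actX x U p) = x u (coeff x y g U u p) := by
    simp [coeff_apply, actX_apply, h1, h3]
    exact Finset.sum_congr rfl fun w _ => (h2 u w _).symm
  refine LinearMap.ext fun p => ?_
  rw [Module.End.mul_apply, LinearMap.neg_apply, Module.End.mul_apply, actG_apply u (actX x U p),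
    hc, actX_apply, actX_apply, actG_apply]
  simp only [Prod.ext_iff, funext_iff, Prod.fst_neg, Prod.snd_neg, Pi.neg_apply, neg_zero, map_sub,
    map_neg, h3, true_and]
  intro w
  split_ifs with h
  · subst h; abel
  · rw [map_zero]; abel

theorem actY_mul_actG (hyy : ∀ u, y u * y u = 0) (hxy : ∀ u w, x u * y w = -(y w * x u))
    (hyg : ∀ u w, y u * g u w = y w * g u w)
    (hyg' : ∀ u v w, y u * g v w = -(g v w * y u)) (u : V) :
    actY y U * actG x y g U u = -(actG x y g U u * actY y U) := by
  have h1 (u : V) (m : M) : y u (y u m) = 0 := LinearMap.congr_fun (hyy u) m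
  have h2 (u w : V) (m : M) : y u (g u w m) = y w (g u w m) := LinearMap.congr_fun (hyg u w) m
  have h3 (u v w : V) (m : M) : g v w (y u m) = -y u (g v w m) := by
    rw [eq_comm, neg_eq_iff_eq_neg]; exact LinearMap.congr_fun (hyg' u v w) m
  have h4 (u w : V) (m : M) : x u (y w m) = -y w (x u m) := LinearMap.congr_fun (hxy u w) m
  have hc (p : Space M U) : coeff x y g U u (actY y U p) = y u (coeff x y g U u p) := by
    simp [coeff_apply, actY_apply, h1, h3, h4]
    exact Finset.sum_congr rfl fun w _ => (h2 u w _).symm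
  refine LinearMap.ext fun p => ?_
  rw [Module.End.mul_apply, LinearMap.neg_apply, Module.End.mul_apply, actG_apply u (actY y U p),
    hc, actY_apply, actY_apply, actG_apply]
  simp only [Prod.ext_iff, funext_iff, Prod.fst_neg, Prod.snd_neg, Pi.neg_apply, neg_zero, map_sub,
    map_neg, h3, true_and]
  intro w
  split_ifs with h
  · subst h; abel
  · rw [map_zero]; abel

theorem actX_sub_mul_actG (hxg : ∀ u w, x u * g u w = x w * g u w) (u : V) :
    (actX x U - extend U (x u)) * actG x y g U u = 0 := by
  have h2 (u w : V) (m : M) : x u (g u w m) = x w (g u w m) := LinearMap.congr_fun (hxg u w) m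
  refine LinearMap.ext fun p => ?_
  rw [Module.End.mul_apply, LinearMap.sub_apply, LinearMap.zero_apply, sub_eq_zero, actX_apply,
    extend_apply, actG_apply]
  simp only [Prod.ext_iff, funext_iff, map_sub, map_zero, neg_zero, true_and]
  intro w
  rw [h2]
  split_ifs with h
  · subst h; rfl
  · simp

theorem actY_sub_mul_actG (hyg : ∀ u w, y u * g u w = y w * g u w) (u : V) :
    (actY y U - extend U (y u)) * actG x y g U u = 0 := by
  have h2 (u w : V) (m : M) : y u (g u w m) = y w (g u w m) := LinearMap.congr_fun (hyg u w) m
  refine LinearMap.ext fun p => ?_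
  rw [Module.End.mul_apply, LinearMap.sub_apply, LinearMap.zero_apply, sub_eq_zero, actY_apply,
    extend_apply, actG_apply]
  simp only [Prod.ext_iff, funext_iff, map_sub, map_zero, neg_zero, true_and]
  intro w
  rw [h2]
  split_ifs with h
  · subst h; rfl
  · simp

theorem coeff_actG (u u' : V) (hu' : u' ∈ U) (p : Space M U) :
    coeff x y g U u (actG x y g U u' p) =
      g u u' (coeff x y g U u' p) - ∑ w : U, g u w (g u' w (p.2.2.2.2 w)) := by
  rw [coeff_apply, actG_apply]
  simp only [map_zero, add_zero, zero_add, map_sub, Finset.sum_sub_distrib]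
  congr 1
  rw [Finset.sum_eq_single ⟨u', hu'⟩]
  · simp
  · intro w _ hw
    rw [if_neg fun h => hw (Subtype.ext h), map_zero]
  · simp

theorem actG_mul_self (hgg : ∀ u w, g u w * g u w = 0) (hg : ∀ u, g u u = 0) {u : V}
    (hu : u ∈ U) : actG x y g U u * actG x y g U u = 0 := by
  have h1 (u w : V) (m : M) : g u w (g u w m) = 0 := LinearMap.congr_fun (hgg u w) m
  refine LinearMap.ext fun p => ?_
  rw [Module.End.mul_apply, actG_apply u (actG x y g U u p), coeff_actG u u hu, actG_apply]
  simp only [hg, h1, LinearMap.zero_apply, Finset.sum_const_zero, sub_zero, ite_self, zero_sub,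
    Prod.mk_eq_zero, true_and, map_sub]
  ext w
  split_ifs with h
  · simp [h, hg]
  · simp

/-- The relation for the triangles with vertices `u`, `u'` and `v`. -/
theorem actG_mul_actG (hxg : ∀ u w, x u * g u w = x w * g u w)
    (hyg : ∀ u w, y u * g u w = y w * g u w)
    (hxg' : ∀ u v w, x u * g v w = -(g v w * x u)) (hyg' : ∀ u v w, y u * g v w = -(g v w * y u))
    (hxy : ∀ u w, x u * y w = -(y w * x u))
    {u u' : V} (hu' : u' ∈ U)
    (ht : ∀ w ∈ U, g u w * g u' w = g u u' * (g u' w - g u w)) :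
    actG x y g U u * actG x y g U u' =
      extend U (g u u') * (actG x y g U u' - actG x y g U u) := by
  classical
  have h1 (w : U) (m : M) : g u w (g u' w m) = g u u' (g u' w m - g u w m) :=
    LinearMap.congr_fun (ht w w.2) m
  have h2 (m : M) : g u u' (x u m) = g u u' (x u' m) := by
    have := LinearMap.congr_fun (hxg u u') m
    rw [hxg', hxg'] at this
    exact neg_injective this
  have h3 (m : M) : g u u' (y u m) = g u u' (y u' m) := by
    have := LinearMap.congr_fun (hyg u u') m
    rw [hyg', hyg'] at this
    exact neg_injective this
  have h4 (u w : V) (m : M) : x u (y w m) = -y w (x u m) := LinearMap.congr_fun (hxy u w) m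
  -- After `g u u'` the vertices `u` and `u'` are interchangeable in the `x` and `y` terms, and the
  -- subtracted sum converts the `g u'` terms into `g u` terms.
  have hE (p : Space M U) : g u u' (coeff x y g U u' p) - ∑ w : U, g u w (g u' w (p.2.2.2.2 w)) =
      g u u' (coeff x y g U u p) := by
    have h5 (m : M) : g u u' (x u (y u m)) = g u u' (x u' (y u' m)) := by
      rw [h2, h4, map_neg, h3, ← map_neg, ← h4]
    simp only [coeff_apply, h1, map_add, map_sum, map_sub, Finset.sum_sub_distrib, h2, h3]
    rw [← h2 (y u _), h5]
    abel
  refine LinearMap.ext fun p => ?_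
  rw [Module.End.mul_apply, actG_apply u (actG x y g U u' p), coeff_actG u u' hu', hE,
    Module.End.mul_apply, LinearMap.sub_apply, actG_apply, actG_apply, extend_apply]
  simp only [Prod.ext_iff, funext_iff, Prod.fst_sub, Prod.snd_sub, Pi.sub_apply, map_sub, sub_self,
    map_zero, neg_zero, true_and, h1]
  intro w
  have h6 : g u w (if (w : V) = u' then coeff x y g U u' p else 0) =
      if (w : V) = u' then g u u' (coeff x y g U u' p) else 0 := by
    split_ifs with h
    · rw [h]
    · exact map_zero _
  rw [h6]
  split_ifs <;> (try simp only [map_zero]) <;> abel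

end ConeModule

end SimpleGraph

/-! ### Adjoining a vertex to a module, and iteration along the elimination order. -/

namespace SimpleGraph

universe u

namespace ConeModule

variable {V : Type*} {M : Type*} [AddCommGroup M] [Module ℚ M] (x y : V → Module.End ℚ M)
  (g : V → V → Module.End ℚ M) (U : Finset V) (v : V)

open Classical in
/-- The action of the generators `x_w` on the cone with vertex `v`. -/
noncomputable def coneX (w : V) : Module.End ℚ (Space M U) :=
  if w = v then actX x U else extend U (x w)

open Classical in
/-- The action of the generators `y_w` on the cone with vertex `v`. -/
noncomputable def coneY (w : V) : Module.End ℚ (Space M U) :=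
  if w = v then actY y U else extend U (y w)

open Classical in
/-- The action of the generators `g_{uw}` on the cone with vertex `v`. -/
noncomputable def coneG (u w : V) : Module.End ℚ (Space M U) :=
  if w = v then (if u ∈ U then actG x y g U u else 0)
  else if u = v then (if w ∈ U then actG x y g U w else 0)
  else extend U (g u w)

variable {x y g U v} {Γ : SimpleGraph V}

theorem coneX_self : coneX x U v v = actX x U := if_pos rfl

theorem coneX_of_ne {w : V} (h : w ≠ v) : coneX x U v w = extend U (x w) := if_neg h

theorem coneY_self : coneY y U v v = actY y U := if_pos rfl

theorem coneY_of_ne {w : V} (h : w ≠ v) : coneY y U v w = extend U (y w) := if_neg h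

theorem coneG_right {u : V} (h : u ∈ U) : coneG x y g U v u v = actG x y g U u := by
  rw [coneG, if_pos rfl, if_pos h]

theorem coneG_right_of_notMem {u : V} (h : u ∉ U) : coneG x y g U v u v = 0 := by
  rw [coneG, if_pos rfl, if_neg h]

theorem coneG_of_ne {u w : V} (hu : u ≠ v) (hw : w ≠ v) :
    coneG x y g U v u w = extend U (g u w) := by
  rw [coneG, if_neg hw, if_neg hu]

theorem coneG_comm (h : Γ.IsModelSystem x y g) (u w : V) :
    coneG x y g U v u w = coneG x y g U v w u := by
  unfold coneG
  by_cases hw : w = v <;> by_cases hu : u = v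
  · rw [hw, hu]
  · rw [if_pos hw, if_neg hu, if_pos hw]
  · rw [if_neg hw, if_pos hu, if_pos hu]
  · rw [if_neg hw, if_neg hu, if_neg hu, if_neg hw, h.g_symm]

/-- The sum in `coeff` runs over all of `U`, so the triangle relation is also needed when `w`
coincides with `u` or `u'`; there it reduces to `g u u = 0` and vanishing squares. -/
theorem triangle_of_clique (h : Γ.IsModelSystem x y g)
    (hU : ∀ u ∈ U, ∀ w ∈ U, u ≠ w → Γ.Adj u w) {u u' w : V} (hu : u ∈ U) (hu' : u' ∈ U)
    (hw : w ∈ U) (huu' : u ≠ u') : g u w * g u' w = g u u' * (g u' w - g u w) := by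
  by_cases h1 : u = w
  · subst h1
    rw [h.g_of_not_adj u u (Γ.irrefl), zero_mul, sub_zero, h.g_symm u' u,
      mul_self_eq_zero_of_eq_neg (h.g_mul_g _ _ _ _)]
  by_cases h2 : u' = w
  · subst h2
    rw [h.g_of_not_adj u' u' (Γ.irrefl), mul_zero, zero_sub, mul_neg,
      mul_self_eq_zero_of_eq_neg (h.g_mul_g _ _ _ _), neg_zero]
  exact h.triangle u w u' (hU u hu w hw h1) (hU u' hu' w hw h2) (hU u hu u' hu' huu')

theorem sub_mul_coneG {a : V → Module.End ℚ M} {a' : V → Module.End ℚ (Space M U)}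
    (ha : ∀ u w, (a u - a w) * g u w = 0) (ha' : ∀ w, w ≠ v → a' w = extend U (a w))
    (hav : ∀ u, (a' v - extend U (a u)) * actG x y g U u = 0) (u w : V) :
    (a' u - a' w) * coneG x y g U v u w = 0 := by
  by_cases hu : u = v <;> by_cases hw : w = v
  · rw [hu, hw, sub_self, zero_mul]
  · rw [coneG, if_neg hw, if_pos hu, hu, ha' w hw]
    split_ifs
    · exact hav w
    · exact mul_zero _
  · rw [coneG, if_pos hw, hw, ha' u hu]
    split_ifs
    · have e := hav u
      rw [sub_mul, sub_eq_zero] at e ⊢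
      exact e.symm
    · exact mul_zero _
  · rw [coneG_of_ne hu hw, ha' u hu, ha' w hw, ← extend_sub]
    exact extend_mul_eq_zero (ha u w)

/-- The graph stays fixed throughout the iteration, with vertices not yet adjoined acting by zero.
By `hout` this makes the triangles through `v` and a neighbour outside `U` trivial. -/
theorem isModelSystem (h : Γ.IsModelSystem x y g) (hv : ∀ u ∈ U, Γ.Adj u v)
    (hU : ∀ u ∈ U, ∀ w ∈ U, u ≠ w → Γ.Adj u w)
    (hout : ∀ u, Γ.Adj u v → u ∉ U → ∀ w, g u w = 0) :
    Γ.IsModelSystem (coneX x U v) (coneY y U v) (coneG x y g U v) := by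
  have hvU : v ∉ U := fun h => (hv v h).ne rfl
  have hxx (u : V) : x u * x u = 0 := mul_self_eq_zero_of_eq_neg (h.x_mul_x u u)
  have hyy (u : V) : y u * y u = 0 := mul_self_eq_zero_of_eq_neg (h.y_mul_y u u)
  have hgg (u w : V) : g u w * g u w = 0 := mul_self_eq_zero_of_eq_neg (h.g_mul_g u w u w)
  have hxg (u w : V) : x u * g u w = x w * g u w := by
    rw [← sub_eq_zero, ← sub_mul, h.x_sub_mul_g]
  have hyg (u w : V) : y u * g u w = y w * g u w := by
    rw [← sub_eq_zero, ← sub_mul, h.y_sub_mul_g]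
  have hxg' := fun u v w => h.x_mul_g u v w
  have hyg' := fun u v w => h.y_mul_g u v w
  have hgself (u : V) : g u u = 0 := h.g_of_not_adj u u Γ.irrefl
  have htri {u u' : V} (hu : u ∈ U) (hu' : u' ∈ U) (hne : u ≠ u') :
      actG x y g U u * actG x y g U u' =
        extend U (g u u') * (actG x y g U u' - actG x y g U u) :=
    actG_mul_actG hxg hyg hxg' hyg' h.x_mul_y hu' fun w hw =>
      triangle_of_clique h hU hu hu' hw hne
  let S : Set (Module.End ℚ M) := Set.range x ∪ Set.range y ∪ Set.range (Function.uncurry g)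
  have hSx (w : V) : x w ∈ S := Or.inl (Or.inl ⟨w, rfl⟩)
  have hSy (w : V) : y w ∈ S := Or.inl (Or.inr ⟨w, rfl⟩)
  have hSg (u w : V) : g u w ∈ S := Or.inr ⟨(u, w), rfl⟩
  have hEG {b : Module.End ℚ M} (hb : b ∈ S) (u : V) :
      extend U b * actG x y g U u = -(actG x y g U u * extend U b) :=
    extend_mul_actG (fun w => h.anticomm _ (hSx w) _ hb) (fun w => h.anticomm _ (hSy w) _ hb)
      (fun u w => h.anticomm _ (hSg u w) _ hb) u
  have hEX {b : Module.End ℚ M} (hb : b ∈ S) : extend U b * actX x U = -(actX x U * extend U b) :=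
    extend_mul_actX fun w => h.anticomm _ (hSx w) _ hb
  have hEY {b : Module.End ℚ M} (hb : b ∈ S) : extend U b * actY y U = -(actY y U * extend U b) :=
    extend_mul_actY fun w => h.anticomm _ (hSy w) _ hb
  have hXG (u : V) := actX_mul_actG (U := U) (y := y) hxx hxg hxg' u
  have hYG (u : V) := actY_mul_actG (U := U) hyy h.x_mul_y hyg hyg' u
  have hXY := actX_mul_actY (U := U) fun w => h.x_mul_y w w
  have hXX := actX_mul_actX (U := U) hxx
  have hYY := actY_mul_actY (U := U) hyy
  have hGG {u u' : V} (hu : u ∈ U) (hu' : u' ∈ U) :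
      actG x y g U u * actG x y g U u' = -(actG x y g U u' * actG x y g U u) := by
    by_cases hne : u = u'
    · subst hne
      rw [actG_mul_self hgg hgself hu, neg_zero]
    · rw [htri hu hu' hne, htri hu' hu (Ne.symm hne), h.g_symm u' u, mul_sub, mul_sub]
      exact (neg_sub _ _).symm
  have hflip {a b : Module.End ℚ (Space M U)} (hab : a * b = -(b * a)) : b * a = -(a * b) := by
    rw [hab, neg_neg]
  have hanti : ∀ a b : Module.End ℚ (Space M U),
      (a = 0 ∨ (∃ c ∈ S, a = extend U c) ∨ a = actX x U ∨ a = actY y U ∨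
        ∃ u ∈ U, a = actG x y g U u) →
      (b = 0 ∨ (∃ c ∈ S, b = extend U c) ∨ b = actX x U ∨ b = actY y U ∨
        ∃ u ∈ U, b = actG x y g U u) → a * b = -(b * a) := by
    rintro a b (rfl | ⟨c, hc, rfl⟩ | rfl | rfl | ⟨u, hu, rfl⟩)
      (rfl | ⟨c', hc', rfl⟩ | rfl | rfl | ⟨u', hu', rfl⟩)
    any_goals simp only [zero_mul, mul_zero, neg_zero]
    · exact extend_mul_extend (h.anticomm _ hc _ hc')
    · exact hEX hc
    · exact hEY hc
    · exact hEG hc _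
    · exact hflip (hEX hc')
    · rw [hXX, neg_zero]
    · exact hXY
    · exact hXG _
    · exact hflip (hEY hc')
    · exact hflip hXY
    · rw [hYY, neg_zero]
    · exact hYG _
    · exact hflip (hEG hc' _)
    · exact hflip (hXG _)
    · exact hflip (hYG _)
    · exact hGG hu hu'
  have hform : ∀ a ∈ Set.range (coneX x U v) ∪ Set.range (coneY y U v) ∪
      Set.range (Function.uncurry (coneG x y g U v)),
      a = 0 ∨ (∃ c ∈ S, a = extend U c) ∨ a = actX x U ∨ a = actY y U ∨
        ∃ u ∈ U, a = actG x y g U u := by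
    rintro _ ((⟨w, rfl⟩ | ⟨w, rfl⟩) | ⟨⟨u, w⟩, rfl⟩)
    · unfold coneX
      split_ifs
      · simp
      · exact Or.inr (Or.inl ⟨_, hSx w, rfl⟩)
    · unfold coneY
      split_ifs
      · simp
      · exact Or.inr (Or.inl ⟨_, hSy w, rfl⟩)
    · rw [Function.uncurry_apply_pair]
      unfold coneG
      split_ifs with _ hu _ hw
      · exact Or.inr (Or.inr (Or.inr (Or.inr ⟨_, hu, rfl⟩)))
      · exact Or.inl rfl
      · exact Or.inr (Or.inr (Or.inr (Or.inr ⟨_, hw, rfl⟩)))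
      · exact Or.inl rfl
      · exact Or.inr (Or.inl ⟨_, hSg u w, rfl⟩)
  refine ⟨fun a ha b hb => hanti a b (hform a ha) (hform b hb), coneG_comm h, fun u w huw => ?_,
    ?_, ?_, fun u z w huz hwz huw => ?_⟩
  · unfold coneG
    split_ifs with hw hu hu hw'
    · exact absurd (hw ▸ hv u hu) huw
    · rfl
    · exact absurd (hu ▸ (hv w hw').symm) huw
    · rfl
    · rw [h.g_of_not_adj u w huw]
      exact extend_zero
  · exact sub_mul_coneG h.x_sub_mul_g (fun w hw => coneX_of_ne hw)
      (fun u => by rw [coneX_self]; exact actX_sub_mul_actG hxg u)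
  · exact sub_mul_coneG h.y_sub_mul_g (fun w hw => coneY_of_ne hw)
      (fun u => by rw [coneY_self]; exact actY_sub_mul_actG hyg u)
  -- The cases depend on which vertex of the triangle is `v`. For `z = v` the relation is `htri`;
  -- for `u = v` or `w = v` it follows from `htri` by anticommuting.
  · by_cases hz : z = v
    · subst hz
      rw [coneG_of_ne huz.ne hwz.ne]
      by_cases hu : u ∈ U <;> by_cases hw : w ∈ U
      · rw [coneG_right hu, coneG_right hw, htri hu hw huw.ne]
      · rw [coneG_right_of_notMem hw, h.g_symm u w, hout w hwz hw, extend_zero, mul_zero, zero_mul]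
      · rw [coneG_right_of_notMem hu, hout u huz hu, extend_zero, zero_mul, zero_mul]
      · rw [coneG_right_of_notMem hu, hout u huz hu, extend_zero, zero_mul, zero_mul]
    by_cases hu : u = v
    · subst hu
      have hw : w ≠ u := huw.ne'
      rw [coneG_comm h u z, coneG_comm h u w, coneG_of_ne hw hz]
      by_cases hzU : z ∈ U
      · by_cases hwU : w ∈ U
        · have e := htri hwU hzU hwz.ne
          rw [mul_sub, hEG (hSg _ _), hEG (hSg _ _)] at e
          rw [coneG_right hzU, coneG_right hwU, mul_sub, e]
          abel
        · rw [coneG_right_of_notMem hwU, hout w huw.symm hwU, extend_zero, mul_zero, zero_mul]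
      · rw [coneG_right_of_notMem hzU, h.g_symm w z, hout z huz.symm hzU, extend_zero, sub_zero,
          mul_zero, mul_zero]
    by_cases hw : w = v
    · subst hw
      rw [coneG_comm h w z, coneG_of_ne hu hz]
      by_cases hzU : z ∈ U
      · by_cases huU : u ∈ U
        · have e := htri huU hzU huz.ne
          rw [mul_sub, hEG (hSg _ _) u] at e
          rw [coneG_right hzU, coneG_right huU, mul_sub, e]
          abel
        · rw [coneG_right_of_notMem huU, hout u huw huU, extend_zero, zero_mul, zero_mul]
      · rw [coneG_right_of_notMem hzU, h.g_symm u z, hout z hwz.symm hzU, extend_zero, sub_zero,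
          mul_zero, mul_zero]
    rw [coneG_of_ne hu hz, coneG_of_ne hw hz, coneG_of_ne hu hw, ← extend_sub]
    exact extend_mul_extend_eq (h.triangle u z w huz hwz huw)

/-- If `M` is generated by `e`, then the cone is generated by the copy of `e` attached to the
monomial `1`. -/
theorem eq_top_of_stable (h : Γ.IsModelSystem x y g) (hx0 : x v = 0) (hy0 : y v = 0)
    (hg0 : ∀ w, g v w = 0) {e : M}
    (he : ∀ W : Submodule ℚ M, e ∈ W → (∀ w, ∀ m ∈ W, x w m ∈ W) → (∀ w, ∀ m ∈ W, y w m ∈ W) →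
      (∀ u w, ∀ m ∈ W, g u w m ∈ W) → W = ⊤)
    (W : Submodule ℚ (Space M U)) (heW : ((e, 0, 0, 0, 0) : Space M U) ∈ W)
    (hx : ∀ w, ∀ m ∈ W, coneX x U v w m ∈ W) (hy : ∀ w, ∀ m ∈ W, coneY y U v w m ∈ W)
    (hg : ∀ u w, ∀ m ∈ W, coneG x y g U v u w m ∈ W) : W = ⊤ := by
  classical
  have hext (b : Module.End ℚ M) (m : M) :
      extend U b (m, 0, 0, 0, 0) = ((b m, 0, 0, 0, 0) : Space M U) := by
    simp [extend_apply, Prod.ext_iff, funext_iff]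
  have h1 : W.comap (LinearMap.inl ℚ M (M × M × M × (U → M))) = ⊤ := by
    refine he _ heW (fun w m hm => ?_) (fun w m hm => ?_) (fun u w m hm => ?_)
    -- On `M` itself the generators at `v` act by zero; all others act on the first summand of the
    -- cone as they do on `M`.
    · by_cases hw : w = v
      · rw [hw, hx0]; exact zero_mem _
      · have := hx w _ hm
        rwa [coneX_of_ne hw, LinearMap.inl_apply, Prod.zero_eq_mk, Prod.zero_eq_mk, Prod.zero_eq_mk,
          hext] at this
    · by_cases hw : w = v
      · rw [hw, hy0]; exact zero_mem _
      · have := hy w _ hm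
        rwa [coneY_of_ne hw, LinearMap.inl_apply, Prod.zero_eq_mk, Prod.zero_eq_mk, Prod.zero_eq_mk,
          hext] at this
    · by_cases hu : u = v
      · rw [hu, hg0]; exact zero_mem _
      by_cases hw : w = v
      · rw [hw, h.g_symm, hg0]; exact zero_mem _
      · have := hg u w _ hm
        rwa [coneG_of_ne hu hw, LinearMap.inl_apply, Prod.zero_eq_mk, Prod.zero_eq_mk,
          Prod.zero_eq_mk, hext] at this
  have h1 (m : M) : ((m, 0, 0, 0, 0) : Space M U) ∈ W :=
    (Submodule.mem_comap (f := LinearMap.inl ℚ M (M × M × M × (U → M)))).1 (h1 ▸ Submodule.mem_top)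
  have h2 (m : M) : ((0, m, 0, 0, 0) : Space M U) ∈ W := by
    convert hx v _ (h1 m) using 1
    simp [coneX_self, actX_apply, Prod.ext_iff, funext_iff]
  have h3 (m : M) : ((0, 0, m, 0, 0) : Space M U) ∈ W := by
    convert hy v _ (h1 m) using 1
    simp [coneY_self, actY_apply, Prod.ext_iff, funext_iff]
  have h4 (m : M) : ((0, 0, 0, m, 0) : Space M U) ∈ W := by
    convert hx v _ (h3 m) using 1
    simp [coneX_self, actX_apply, Prod.ext_iff, funext_iff]
  have h5 (u : U) (m : M) : ((0, 0, 0, 0, Pi.single u m) : Space M U) ∈ W := by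
    convert hg u v _ (h1 m) using 1
    rw [coneG_right u.2, actG_apply]
    simp only [Prod.ext_iff, true_and]
    ext w
    simp only [coeff_apply, map_zero, add_zero, Pi.zero_apply, Finset.sum_const_zero, sub_zero,
      Pi.single_apply, Subtype.coe_inj]
  have h6 (f : U → M) : ((0, 0, 0, 0, f) : Space M U) ∈ W := by
    have : ((0, 0, 0, 0, f) : Space M U) = ∑ u, ((0, 0, 0, 0, Pi.single u (f u)) : Space M U) := by
      simp only [Prod.ext_iff, Prod.fst_sum, Prod.snd_sum, Finset.sum_const_zero, true_and]
      exact (Finset.univ_sum_single f).symm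
    rw [this]
    exact Submodule.sum_mem _ fun u _ => h5 u _
  refine eq_top_iff.2 fun p _ => ?_
  obtain ⟨a, b, c, d, f⟩ := p
  convert add_mem (add_mem (add_mem (add_mem (h1 a) (h2 b)) (h3 c)) (h4 d)) (h6 f) using 1
  simp only [Prod.mk_add_mk, add_zero, zero_add]

theorem finrank_space [Module.Finite ℚ M] :
    Module.finrank ℚ (Space M U) = (U.card + 4) * Module.finrank ℚ M := by
  rw [Module.finrank_prod, Module.finrank_prod, Module.finrank_prod, Module.finrank_prod,
    Module.finrank_pi_fintype, Finset.sum_const, Finset.card_univ, Fintype.card_coe, smul_eq_mul]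
  ring

end ConeModule

open Classical in
/-- The neighbours of a vertex which precede it. -/
noncomputable def lowerNeighbors {V : Type*} [Fintype V] (Γ : SimpleGraph V) (o : V → ℕ) (v : V) :
    Finset V :=
  Finset.univ.filter fun u => Γ.Adj u v ∧ o u < o v

theorem mem_lowerNeighbors {V : Type*} [Fintype V] {Γ : SimpleGraph V} {o : V → ℕ} {u v : V} :
    u ∈ Γ.lowerNeighbors o v ↔ Γ.Adj u v ∧ o u < o v := by
  simp [lowerNeighbors]

open Classical in
/-- The model of the subgraph on the first `n` vertices has a cyclic module of the expected
dimension. -/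
theorem IsPerfectElimination.exists_module {V : Type u} [Fintype V] {Γ : SimpleGraph V}
    {o : V → ℕ} (ho : Function.Injective o) (hΓ : Γ.IsPerfectElimination o) (n : ℕ) :
    ∃ (M : Type u) (_ : AddCommGroup M) (_ : Module ℚ M) (x y : V → Module.End ℚ M)
      (g : V → V → Module.End ℚ M) (e : M), Γ.IsModelSystem x y g ∧
      (∀ v, n ≤ o v → x v = 0 ∧ y v = 0 ∧ ∀ w, g v w = 0) ∧ Module.Finite ℚ M ∧
      Module.finrank ℚ M = ∏ v with o v < n, ((Γ.lowerNeighbors o v).card + 4) ∧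
      ∀ W : Submodule ℚ M, e ∈ W → (∀ w, ∀ m ∈ W, x w m ∈ W) → (∀ w, ∀ m ∈ W, y w m ∈ W) →
        (∀ u w, ∀ m ∈ W, g u w m ∈ W) → W = ⊤ := by
  induction n with
  | zero =>
    -- A copy of `ℚ` in the universe of `V`, on which every generator acts by zero.
    refine ⟨PUnit → ℚ, inferInstance, inferInstance, 0, 0, 0, fun _ => 1, ?_, by simp,
      inferInstance, by simp, fun W he _ _ _ => ?_⟩
    · refine ⟨?_, by simp, by simp, by simp, by simp, by simp⟩
      rintro a ((⟨_, rfl⟩ | ⟨_, rfl⟩) | ⟨⟨_, _⟩, rfl⟩) b - <;> simp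
    · refine eq_top_iff.2 fun f _ => ?_
      convert W.smul_mem (f PUnit.unit) he using 1
      ext
      simp
  | succ n ih =>
    obtain ⟨M, _, _, x, y, g, e, h, h0, hfin, hrank, hcyc⟩ := ih
    by_cases hn : ∃ v, o v = n
    · obtain ⟨v, hv⟩ := hn
      have hmem (u : V) : u ∈ Γ.lowerNeighbors o v ↔ Γ.Adj u v ∧ o u < n := by
        rw [mem_lowerNeighbors, hv]
      have hne {w : V} (hw : n + 1 ≤ o w) : w ≠ v := fun h => by rw [h, hv] at hw; omega
      have hsys : Γ.IsModelSystem (ConeModule.coneX x (Γ.lowerNeighbors o v) v)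
          (ConeModule.coneY y (Γ.lowerNeighbors o v) v)
          (ConeModule.coneG x y g (Γ.lowerNeighbors o v) v) := by
        refine ConeModule.isModelSystem h (fun u hu => ((hmem u).1 hu).1) (fun u hu w hw huw => ?_)
          fun u huv hu => ?_
        · rw [mem_lowerNeighbors] at hu hw
          exact hΓ u v w hu.1 hw.1 hu.2 hw.2 huw
        · exact (h0 u (not_lt.1 fun hlt => hu ((hmem u).2 ⟨huv, hlt⟩))).2.2
      refine ⟨ConeModule.Space M (Γ.lowerNeighbors o v), inferInstance, inferInstance, _, _, _,
        (e, 0, 0, 0, 0), hsys, fun w hw => ⟨?_, ?_, fun u => ?_⟩, inferInstance, ?_, ?_⟩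
      · rw [ConeModule.coneX_of_ne (hne hw), (h0 w (by omega)).1, ConeModule.extend_zero]
      · rw [ConeModule.coneY_of_ne (hne hw), (h0 w (by omega)).2.1, ConeModule.extend_zero]
      · by_cases hu : u = v
        · rw [hu, ConeModule.coneG_right_of_notMem]
          rw [hmem]
          omega
        · rw [ConeModule.coneG_of_ne (hne hw) hu, (h0 w (by omega)).2.2, ConeModule.extend_zero]
      · rw [ConeModule.finrank_space, hrank]
        have : (Finset.univ.filter fun w => o w < n + 1) =
            insert v (Finset.univ.filter fun w => o w < n) := by
          ext w
          simp only [Finset.mem_filter, Finset.mem_univ, true_and, Finset.mem_insert]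
          rw [Nat.lt_succ_iff_lt_or_eq, or_comm, ← hv, ho.eq_iff]
        rw [this, Finset.prod_insert (by simp [hv])]
      · obtain ⟨h1, h2, h3⟩ := h0 v hv.ge
        exact ConeModule.eq_top_of_stable h h1 h2 h3 hcyc
    · refine ⟨M, _, _, x, y, g, e, h, fun v hv => h0 v (by omega), hfin, ?_, hcyc⟩
      rw [hrank]
      congr 1
      ext w
      have : o w ≠ n := fun h => hn ⟨w, h⟩
      simp only [Finset.mem_filter, Finset.mem_univ, true_and]
      omega

end SimpleGraph

/-! ## Koszulness of the model of a chordal graph -/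

namespace SimpleGraph

open AbelianModel

universe u

theorem finiteDimensional_exteriorAlgebra {M : Type*} [AddCommGroup M] [Module ℚ M]
    [Module.Finite ℚ M] : Module.Finite ℚ (ExteriorAlgebra ℚ M) := by
  have h0 (i : ℕ) (hi : Module.finrank ℚ M < i) : (⋀[ℚ]^i M) = ⊥ := by
    rw [← Submodule.finrank_eq_zero, exteriorPower.finrank_eq, Nat.choose_eq_zero_of_lt hi]
  have h1 : ⨆ i : Fin (Module.finrank ℚ M + 1), (⋀[ℚ]^(i : ℕ) M) = ⊤ := by
    rw [eq_top_iff, ← (DirectSum.Decomposition.isInternal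
      (fun i : ℕ => ⋀[ℚ]^i M)).submodule_iSup_eq_top, iSup_le_iff]
    intro i
    by_cases hi : i < Module.finrank ℚ M + 1
    · exact le_iSup (fun i : Fin (Module.finrank ℚ M + 1) => ⋀[ℚ]^(i : ℕ) M) ⟨i, hi⟩
    · rw [h0 i (by omega)]
      exact bot_le
  have h2 : Module.Finite ℚ
      (⨆ i : Fin (Module.finrank ℚ M + 1), (⋀[ℚ]^(i : ℕ) M) : Submodule ℚ _) :=
    Submodule.finiteDimensional_iSup _
  rw [h1] at h2
  exact Module.Finite.equiv (Submodule.topEquiv (R := ℚ) (M := ExteriorAlgebra ℚ M))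

variable {V : Type u}

theorem finite_modelGen [Finite V] (Γ : SimpleGraph V) : Finite (ModelGen Γ) := by
  refine Finite.of_injective (β := V ⊕ V ⊕ Γ.edgeSet)
    (fun a => match a with
      | .x v => Sum.inl v
      | .y v => Sum.inr (Sum.inl v)
      | .g e => Sum.inr (Sum.inr e)) ?_
  rintro (v | v | e) (w | w | e') h <;> simp_all

namespace AbelianModel

variable [LinearOrder V] {Γ : SimpleGraph V}

theorem finiteDimensional [Finite V] : Module.Finite ℚ (AbelianModel Γ) := by
  have := finite_modelGen Γ
  have := finiteDimensional_exteriorAlgebra (M := ModelGen Γ →₀ ℚ)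
  exact Module.Finite.of_surjective (mk Γ).toLinearMap (RingQuot.mkAlgHom_surjective ℚ _)

theorem x_mem (v : V) : x Γ v ∈ grading Γ 1 := ⟨_, modelGen_mem Γ _, rfl⟩

theorem y_mem (v : V) : y Γ v ∈ grading Γ 1 := ⟨_, modelGen_mem Γ _, rfl⟩

theorem g_mem (u w : V) : g Γ u w ∈ grading Γ 1 := by
  by_cases h : Γ.Adj u w
  · rw [g_of_adj h]; exact ⟨_, modelGen_mem Γ _, rfl⟩
  · rw [g, dif_neg h]; exact zero_mem _

theorem grading_zero : grading Γ 0 = 1 := by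
  rw [grading, ExteriorAlgebra.exteriorPower, pow_zero]
  exact Submodule.map_one (mk Γ)

/-- Acting on the cyclic vector `e` maps the model onto the module: the image contains `e` and is
stable under the generators. -/
theorem le_finrank [Fintype V] {o : V → ℕ} (ho : Function.Injective o)
    (hΓ : Γ.IsPerfectElimination o) (n : ℕ) :
    ∏ v with o v < n, ((Γ.lowerNeighbors o v).card + 4) ≤ Module.finrank ℚ (AbelianModel Γ) := by
  have := finiteDimensional (Γ := Γ)
  obtain ⟨M, _, _, X, Y, G, e, h, -, hfin, hrank, hcyc⟩ := hΓ.exists_module ho n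
  obtain ⟨φ, hX, hY, hG⟩ := h.exists_algHom ho hΓ
  let ψ : AbelianModel Γ →ₗ[ℚ] M := (LinearMap.applyₗ e) ∘ₗ φ.toLinearMap
  have hψ (a b : AbelianModel Γ) : φ a (ψ b) = ψ (a * b) := by
    change φ a (φ b e) = φ (a * b) e
    rw [map_mul]
    rfl
  have htop : LinearMap.range ψ = ⊤ := by
    refine hcyc _ ⟨1, ?_⟩ ?_ ?_ ?_
    · change φ 1 e = e
      rw [map_one]
      rfl
    · rintro w _ ⟨a, rfl⟩
      exact ⟨x Γ w * a, by rw [← hψ, ← hX]; rfl⟩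
    · rintro w _ ⟨a, rfl⟩
      exact ⟨y Γ w * a, by rw [← hψ, ← hY]; rfl⟩
    · rintro u w _ ⟨a, rfl⟩
      by_cases huw : Γ.Adj u w
      · exact ⟨g Γ u w * a, by rw [← hψ, ← hG u w huw, g_of_adj huw]⟩
      · rw [h.g_of_not_adj u w huw]
        exact zero_mem _
  rw [← hrank]
  exact LinearMap.finrank_le_finrank_of_surjective (LinearMap.range_eq_top.1 htop)

/-! ### The ideals of the filtration and their colon ideals. -/

variable (Γ) (o : V → ℕ)

/-- The left ideal generated by the generators belonging to the first `n` vertices. -/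
noncomputable def vertexIdeal (n : ℕ) : Ideal (AbelianModel Γ) :=
  Ideal.span (x Γ '' {v | o v < n} ∪ y Γ '' {v | o v < n} ∪
    Function.uncurry (g Γ) '' {p | o p.1 < n ∧ o p.2 < n})

/-- The left ideal generated by the generators belonging to the vertices before `v`, the `g_{uv}`
and `x_v`. -/
noncomputable def partialVertexIdeal [Fintype V] (v : V) : Ideal (AbelianModel Γ) :=
  vertexIdeal Γ o (o v) ⊔ Ideal.span ((fun u => g Γ u v) '' Γ.lowerNeighbors o v) ⊔
    Ideal.span {x Γ v}

variable {Γ o}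

theorem x_mem_vertexIdeal {n : ℕ} {v : V} (h : o v < n) : x Γ v ∈ vertexIdeal Γ o n :=
  Ideal.subset_span (Or.inl (Or.inl ⟨v, h, rfl⟩))

theorem y_mem_vertexIdeal {n : ℕ} {v : V} (h : o v < n) : y Γ v ∈ vertexIdeal Γ o n :=
  Ideal.subset_span (Or.inl (Or.inr ⟨v, h, rfl⟩))

theorem g_mem_vertexIdeal {n : ℕ} {u w : V} (hu : o u < n) (hw : o w < n) :
    g Γ u w ∈ vertexIdeal Γ o n :=
  Ideal.subset_span (Or.inr ⟨(u, w), ⟨hu, hw⟩, rfl⟩)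

theorem vertexIdeal_le_iff {n : ℕ} {I : Ideal (AbelianModel Γ)} : vertexIdeal Γ o n ≤ I ↔
    (∀ v, o v < n → x Γ v ∈ I) ∧ (∀ v, o v < n → y Γ v ∈ I) ∧
      ∀ u w, o u < n → o w < n → g Γ u w ∈ I := by
  refine ⟨fun h => ⟨fun v hv => h (x_mem_vertexIdeal hv), fun v hv => h (y_mem_vertexIdeal hv),
    fun u w hu hw => h (g_mem_vertexIdeal hu hw)⟩, fun ⟨h1, h2, h3⟩ => Ideal.span_le.2 ?_⟩
  rintro _ ((⟨v, hv, rfl⟩ | ⟨v, hv, rfl⟩) | ⟨⟨u, w⟩, ⟨hu, hw⟩, rfl⟩)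
  · exact h1 v hv
  · exact h2 v hv
  · exact h3 u w hu hw

theorem vertexIdeal_mono : Monotone (vertexIdeal Γ o) := fun _ _ h =>
  vertexIdeal_le_iff.2 ⟨fun _ hv => x_mem_vertexIdeal (hv.trans_le h),
    fun _ hv => y_mem_vertexIdeal (hv.trans_le h),
    fun _ _ hu hw => g_mem_vertexIdeal (hu.trans_le h) (hw.trans_le h)⟩

theorem vertexIdeal_zero : vertexIdeal Γ o 0 = ⊥ :=
  le_bot_iff.1 (vertexIdeal_le_iff.2 ⟨by simp, by simp, by simp⟩)

theorem vertexIdeal_succ_of_forall_ne {n : ℕ} (hn : ∀ v, o v ≠ n) :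
    vertexIdeal Γ o (n + 1) = vertexIdeal Γ o n := by
  have h (v : V) (hv : o v < n + 1) : o v < n := by
    have := hn v
    omega
  exact le_antisymm (vertexIdeal_le_iff.2 ⟨fun _ hv => x_mem_vertexIdeal (h _ hv),
    fun _ hv => y_mem_vertexIdeal (h _ hv),
    fun _ _ hu hw => g_mem_vertexIdeal (h _ hu) (h _ hw)⟩) (vertexIdeal_mono n.le_succ)

theorem g_mem_sup [Fintype V] {u v : V} (hu : o u < o v) :
    g Γ u v ∈ vertexIdeal Γ o (o v) ⊔ Ideal.span ((fun u => g Γ u v) '' Γ.lowerNeighbors o v) := by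
  by_cases h : Γ.Adj u v
  · exact Submodule.mem_sup_right (Ideal.subset_span ⟨u, mem_lowerNeighbors.2 ⟨h, hu⟩, rfl⟩)
  · rw [g, dif_neg h]
    exact zero_mem _

theorem vertexIdeal_succ [Fintype V] (ho : Function.Injective o) (v : V) :
    partialVertexIdeal Γ o v ⊔ Ideal.span {y Γ v} = vertexIdeal Γ o (o v + 1) := by
  have hlt {w : V} (hw : o w < o v + 1) : o w < o v ∨ w = v :=
    (Nat.lt_succ_iff_lt_or_eq.1 hw).imp_right fun h => ho h
  refine le_antisymm (sup_le (sup_le (sup_le (vertexIdeal_mono (Nat.le_succ _)) ?_) ?_) ?_)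
    (vertexIdeal_le_iff.2 ⟨fun w hw => ?_, fun w hw => ?_, fun u w hu hw => ?_⟩)
  · rw [Ideal.span_le]
    rintro _ ⟨u, hu, rfl⟩
    exact g_mem_vertexIdeal ((mem_lowerNeighbors.1 hu).2.trans (Nat.lt_succ_self _))
      (Nat.lt_succ_self _)
  · rw [Ideal.span_singleton_le_iff_mem]
    exact x_mem_vertexIdeal (Nat.lt_succ_self _)
  · rw [Ideal.span_singleton_le_iff_mem]
    exact y_mem_vertexIdeal (Nat.lt_succ_self _)
  · rcases hlt hw with hw | rfl
    · exact Submodule.mem_sup_left (Submodule.mem_sup_left (Submodule.mem_sup_left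
        (x_mem_vertexIdeal hw)))
    · exact Submodule.mem_sup_left (Submodule.mem_sup_right (Ideal.mem_span_singleton_self _))
  · rcases hlt hw with hw | rfl
    · exact Submodule.mem_sup_left (Submodule.mem_sup_left (Submodule.mem_sup_left
        (y_mem_vertexIdeal hw)))
    · exact Submodule.mem_sup_right (Ideal.mem_span_singleton_self _)
  · refine Submodule.mem_sup_left (Submodule.mem_sup_left ?_)
    rcases hlt hu with hu | rfl <;> rcases hlt hw with hw | rfl
    · exact Submodule.mem_sup_left (g_mem_vertexIdeal hu hw)
    · exact g_mem_sup hu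
    · rw [g_comm]
      exact g_mem_sup hw
    · rw [g, dif_neg Γ.irrefl]
      exact zero_mem _

/-- Left ideals generated by generators of the model are stable under right multiplication by
generators. -/
theorem vertexIdeal_le_colon (n : ℕ) {c : AbelianModel Γ}
    (hc : c ∈ Set.range (x Γ) ∪ Set.range (y Γ) ∪ Set.range (Function.uncurry (g Γ))) :
    vertexIdeal Γ o n ≤ (vertexIdeal Γ o n).colon {c} := by
  have h := isModelSystem Γ
  have key {a : AbelianModel Γ}
      (ha : a ∈ Set.range (x Γ) ∪ Set.range (y Γ) ∪ Set.range (Function.uncurry (g Γ)))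
      (han : a ∈ vertexIdeal Γ o n) : a ∈ (vertexIdeal Γ o n).colon {c} := by
    rw [Submodule.mem_colon_singleton, smul_eq_mul, h.anticomm a ha c hc]
    exact neg_mem (Ideal.mul_mem_left _ c han)
  exact vertexIdeal_le_iff.2
    ⟨fun v hv => key (Or.inl (Or.inl ⟨v, rfl⟩)) (x_mem_vertexIdeal hv),
    fun v hv => key (Or.inl (Or.inr ⟨v, rfl⟩)) (y_mem_vertexIdeal hv),
    fun u w hu hw => key (Or.inr ⟨(u, w), rfl⟩) (g_mem_vertexIdeal hu hw)⟩

section Colon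

variable [Fintype V] (v : V)

/-- Multiplied by `g_{wv}`, the elements `x_v`, `y_v` become `x_w`, `y_w`, and `g_{uv}` becomes a
multiple of `g_{uw}` by the triangle relation, as `u` and `w` are adjacent. All of these lie on
earlier vertices. -/
theorem vertexIdeal_succ_le_colon_g (ho : Function.Injective o) (hΓ : Γ.IsPerfectElimination o)
    {w : V} (hw : w ∈ Γ.lowerNeighbors o v) :
    vertexIdeal Γ o (o v + 1) ≤ (vertexIdeal Γ o (o v)).colon {g Γ w v} := by
  have h := isModelSystem Γ
  obtain ⟨hwv, hlt⟩ := mem_lowerNeighbors.1 hw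
  rw [← vertexIdeal_succ ho]
  refine sup_le (sup_le (sup_le (vertexIdeal_le_colon _ (Or.inr ⟨(w, v), rfl⟩)) ?_) ?_) ?_
  · rw [Ideal.span_le]
    rintro _ ⟨u, hu, rfl⟩
    obtain ⟨huv, hult⟩ := mem_lowerNeighbors.1 hu
    rw [SetLike.mem_coe, Submodule.mem_colon_singleton, smul_eq_mul]
    by_cases huw : u = w
    · subst huw
      rw [mul_self_eq_zero_of_eq_neg (h.g_mul_g _ _ _ _)]
      exact zero_mem _
    · rw [h.triangle u v w huv hwv (hΓ u v w huv hwv hult hlt huw), mul_sub, h.g_mul_g u w,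
        h.g_mul_g u w]
      exact sub_mem (neg_mem (Ideal.mul_mem_left _ _ (g_mem_vertexIdeal hult hlt)))
        (neg_mem (Ideal.mul_mem_left _ _ (g_mem_vertexIdeal hult hlt)))
  · rw [Ideal.span_singleton_le_iff_mem, Submodule.mem_colon_singleton, smul_eq_mul]
    have := h.x_sub_mul_g w v
    rw [sub_mul, sub_eq_zero] at this
    rw [← this, h.x_mul_g]
    exact neg_mem (Ideal.mul_mem_left _ _ (x_mem_vertexIdeal hlt))
  · rw [Ideal.span_singleton_le_iff_mem, Submodule.mem_colon_singleton, smul_eq_mul]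
    have := h.y_sub_mul_g w v
    rw [sub_mul, sub_eq_zero] at this
    rw [← this, h.y_mul_g]
    exact neg_mem (Ideal.mul_mem_left _ _ (y_mem_vertexIdeal hlt))

theorem partialVertexIdeal_le_colon_x :
    partialVertexIdeal Γ o v ≤ (vertexIdeal Γ o (o v) ⊔
      Ideal.span ((fun u => g Γ u v) '' Γ.lowerNeighbors o v)).colon {x Γ v} := by
  have h := isModelSystem Γ
  refine sup_le (sup_le ((vertexIdeal_le_colon _ (Or.inl (Or.inl ⟨v, rfl⟩))).trans
    (Submodule.colon_mono le_sup_left le_rfl)) ?_) ?_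
  · rw [Ideal.span_le]
    rintro _ ⟨u, hu, rfl⟩
    rw [SetLike.mem_coe, Submodule.mem_colon_singleton, smul_eq_mul, ← neg_eq_iff_eq_neg.2
      (h.x_mul_g v u v)]
    exact neg_mem (Ideal.mul_mem_left _ _ (Submodule.mem_sup_right (Ideal.subset_span ⟨u, hu, rfl⟩)))
  · rw [Ideal.span_singleton_le_iff_mem, Submodule.mem_colon_singleton, smul_eq_mul,
      mul_self_eq_zero_of_eq_neg (h.x_mul_x v v)]
    exact zero_mem _

theorem vertexIdeal_succ_le_colon_y (ho : Function.Injective o) :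
    vertexIdeal Γ o (o v + 1) ≤ (partialVertexIdeal Γ o v).colon {y Γ v} := by
  have h := isModelSystem Γ
  rw [← vertexIdeal_succ ho]
  refine sup_le (sup_le (sup_le ((vertexIdeal_le_colon _ (Or.inl (Or.inr ⟨v, rfl⟩))).trans
    (Submodule.colon_mono (le_sup_left.trans le_sup_left) le_rfl)) ?_) ?_) ?_
  · rw [Ideal.span_le]
    rintro _ ⟨u, hu, rfl⟩
    rw [SetLike.mem_coe, Submodule.mem_colon_singleton, smul_eq_mul, ← neg_eq_iff_eq_neg.2
      (h.y_mul_g v u v)]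
    exact neg_mem (Ideal.mul_mem_left _ _ (Submodule.mem_sup_left (Submodule.mem_sup_right
      (Ideal.subset_span ⟨u, hu, rfl⟩))))
  · rw [Ideal.span_singleton_le_iff_mem, Submodule.mem_colon_singleton, smul_eq_mul, h.x_mul_y]
    exact neg_mem (Ideal.mul_mem_left _ _ (Submodule.mem_sup_right
      (Ideal.mem_span_singleton_self _)))
  · rw [Ideal.span_singleton_le_iff_mem, Submodule.mem_colon_singleton, smul_eq_mul,
      mul_self_eq_zero_of_eq_neg (h.y_mul_y v v)]
    exact zero_mem _

end Colon

/-- A homogeneous element of positive degree is a sum of products whose last factor is linear, which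
suffices for a left ideal. -/
theorem grading_succ_le_vertexIdeal {n : ℕ} (hn : ∀ v, o v < n) (i : ℕ) :
    ∀ a ∈ grading Γ (i + 1), a ∈ vertexIdeal Γ o n := by
  have hgen (a : ModelGen Γ) : mk Γ (modelGen Γ a) ∈ vertexIdeal Γ o n := by
    rcases a with v | v | ⟨e, he⟩
    · exact x_mem_vertexIdeal (hn v)
    · exact y_mem_vertexIdeal (hn v)
    · induction e with | _ u w =>
      have := g_mem_vertexIdeal (Γ := Γ) (hn u) (hn w)
      rwa [g_of_adj he] at this
  have hι (f : ModelGen Γ →₀ ℚ) : mk Γ (ExteriorAlgebra.ι ℚ f) ∈ vertexIdeal Γ o n := by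
    induction f using Finsupp.induction_linear with
    | zero => rw [map_zero, map_zero]; exact zero_mem _
    | add f1 f2 h1 h2 => rw [map_add, map_add]; exact add_mem h1 h2
    | single a r =>
      rw [← mul_one r, ← smul_eq_mul, ← Finsupp.smul_single, map_smul, map_smul, Algebra.smul_def]
      exact Ideal.mul_mem_left _ _ (hgen a)
  rintro _ ⟨b, hb, rfl⟩
  rw [SetLike.mem_coe, ExteriorAlgebra.exteriorPower, pow_succ] at hb
  induction hb using Submodule.mul_induction_on' with
  | mem_mul_mem m _ f hf =>
    obtain ⟨f, rfl⟩ := hf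
    rw [AlgHom.toLinearMap_apply, map_mul]
    exact Ideal.mul_mem_left _ _ (hι f)
  | add a _ b _ ha hb => rw [map_add]; exact add_mem ha hb

theorem irrelevant_eq_vertexIdeal {n : ℕ} (hn : ∀ v, o v < n) :
    (HomogeneousIdeal.irrelevant (grading Γ)).toIdeal = vertexIdeal Γ o n := by
  refine le_antisymm ?_ (vertexIdeal_le_iff.2
    ⟨fun v _ => HomogeneousIdeal.mem_irrelevant_of_mem _ one_pos (x_mem v),
    fun v _ => HomogeneousIdeal.mem_irrelevant_of_mem _ one_pos (y_mem v),
    fun u w _ _ => HomogeneousIdeal.mem_irrelevant_of_mem _ one_pos (g_mem u w)⟩)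
  rw [HomogeneousIdeal.toIdeal_irrelevant_le]
  intro i hi a ha
  obtain ⟨i, rfl⟩ := Nat.exists_eq_succ_of_ne_zero hi.ne'
  exact grading_succ_le_vertexIdeal hn i a ha

theorem finrank_quotient_vertexIdeal_le_one {n : ℕ} (hn : ∀ v, o v < n) :
    Module.finrank ℚ (AbelianModel Γ ⧸ vertexIdeal Γ o n) ≤ 1 := by
  refine finrank_le_one (Submodule.Quotient.mk 1) fun a => ?_
  obtain ⟨a, rfl⟩ := Submodule.Quotient.mk_surjective _ a
  have h0 : (DirectSum.decompose (grading Γ) a 0 : AbelianModel Γ) ∈ (1 : Submodule ℚ _) :=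
    grading_zero (Γ := Γ) ▸ SetLike.coe_mem _
  obtain ⟨r, hr⟩ := Submodule.mem_one.1 h0
  refine ⟨r, ?_⟩
  rw [← Submodule.Quotient.mk_smul, ← Algebra.algebraMap_eq_smul_one, hr, eq_comm,
    Submodule.Quotient.eq, ← irrelevant_eq_vertexIdeal hn]
  change _ ∈ HomogeneousIdeal.irrelevant (grading Γ)
  rw [HomogeneousIdeal.mem_irrelevant_iff, GradedRing.proj_apply, DirectSum.decompose_sub,
    DirectSum.decompose_coe, DirectSum.sub_apply, DirectSum.of_eq_same, sub_self,
    ZeroMemClass.coe_zero]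

theorem isKoszul_of_isPerfectElimination [Fintype V] (ho : Function.Injective o)
    (hn : ∀ v, o v < Fintype.card V) (hΓ : Γ.IsPerfectElimination o) : IsKoszul (grading Γ) := by
  classical
  have := finiteDimensional (Γ := Γ)
  set N := Fintype.card V
  let P : ℕ → ℕ := fun k => ∏ v with o v < k, ((Γ.lowerNeighbors o v).card + 4)
  let D : ℕ → ℕ := fun k => Module.finrank ℚ (AbelianModel Γ ⧸ vertexIdeal Γ o k)
  have hP0 (k : ℕ) : 0 < P k := Finset.prod_pos fun _ _ => Nat.succ_pos _
  have hPsucc (v : V) : P (o v + 1) = ((Γ.lowerNeighbors o v).card + 4) * P (o v) := by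
    have : (Finset.univ.filter fun w => o w < o v + 1) =
        insert v (Finset.univ.filter fun w => o w < o v) := by
      ext w
      simp only [Finset.mem_filter, Finset.mem_univ, true_and, Finset.mem_insert]
      rw [Nat.lt_succ_iff_lt_or_eq, or_comm, ho.eq_iff]
    change ∏ w with o w < o v + 1, _ = _
    rw [this, Finset.prod_insert (by simp)]
  -- At a vertex, `P` is multiplied by `|U_v| + 4`, while `D` shrinks by at most this factor.
  have hmono : Monotone fun k => P k * D k := by
    refine monotone_nat_of_le_succ fun k => ?_
    by_cases hk : ∃ v, o v = k
    · obtain ⟨v, rfl⟩ := hk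
      have := finrank_quotient_le_card_add_four_mul ℚ (g := fun u => g Γ u v) (x := x Γ v)
        (y := y Γ v) (fun w hw => vertexIdeal_succ_le_colon_g v ho hΓ hw)
        (partialVertexIdeal_le_colon_x v) (vertexIdeal_succ_le_colon_y v ho) (vertexIdeal_succ ho v)
      calc P (o v) * D (o v) ≤ P (o v) * (((Γ.lowerNeighbors o v).card + 4) * D (o v + 1)) :=
            Nat.mul_le_mul_left _ this
        _ = P (o v + 1) * D (o v + 1) := by rw [hPsucc]; ring
    · push Not at hk
      refine Nat.mul_le_mul ?_ (congrArg (fun I : Ideal (AbelianModel Γ) =>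
        Module.finrank ℚ (AbelianModel Γ ⧸ I)) (vertexIdeal_succ_of_forall_ne hk)).ge
      refine (Finset.prod_congr (Finset.filter_congr fun w _ => ?_) fun _ _ => rfl).le
      have := hk w
      omega
  have hfin : P N ≤ D 0 := by
    have e : D 0 = Module.finrank ℚ (AbelianModel Γ) := by
      change Module.finrank ℚ (_ ⧸ vertexIdeal Γ o 0) = _
      rw [vertexIdeal_zero]
      exact ((Submodule.quotEquivOfEqBot _ rfl).restrictScalars ℚ).finrank_eq
    rw [e]
    exact le_finrank ho hΓ N
  -- The monotone function `P k * D k` ends at no more than `P N` and starts at no less, by the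
  -- lower bound for `dim A`; so it is constant and every step estimate is sharp.
  have hconst (k : ℕ) (hk : k < N) : P (k + 1) * D (k + 1) ≤ P k * D k := by
    calc P (k + 1) * D (k + 1) ≤ P N * D N := hmono hk
      _ ≤ P N * 1 := Nat.mul_le_mul_left _ (finrank_quotient_vertexIdeal_le_one hn)
      _ ≤ P 0 * D 0 := by
        rw [mul_one]
        exact hfin.trans (Nat.le_mul_of_pos_left _ (hP0 0))
      _ ≤ P k * D k := hmono k.zero_le
  have : Nontrivial (AbelianModel Γ) :=
    Module.nontrivial_of_finrank_pos (R := ℚ) ((hP0 N).trans_le (le_finrank ho hΓ N))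
  let F : Set (Ideal (AbelianModel Γ)) :=
    Set.range (vertexIdeal Γ o) ∪ Set.range (partialVertexIdeal Γ o)
  have hstep (v : V) (h : LinearFiltration F (grading Γ 1 : Set (AbelianModel Γ))
      (vertexIdeal Γ o (o v))) :
      LinearFiltration F (grading Γ 1 : Set (AbelianModel Γ)) (partialVertexIdeal Γ o v) ∧
      LinearFiltration F (grading Γ 1 : Set (AbelianModel Γ)) (vertexIdeal Γ o (o v + 1)) := by
    refine LinearFiltration.fibration_step ℚ (g := fun u => g Γ u v) (x := x Γ v) (y := y Γ v)
      (fun w hw => vertexIdeal_succ_le_colon_g v ho hΓ hw)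
      (partialVertexIdeal_le_colon_x v) (vertexIdeal_succ_le_colon_y v ho) (vertexIdeal_succ ho v)
      ?_ (Or.inl ⟨_, rfl⟩) (Or.inr ⟨_, rfl⟩) (fun w _ => g_mem w v) (x_mem v) (y_mem v) h
    have e := hconst (o v) (hn v)
    rw [hPsucc, mul_comm _ (P (o v)), mul_assoc] at e
    exact Nat.le_of_mul_le_mul_left e (hP0 _)
  have hvertex (k : ℕ) : LinearFiltration F (grading Γ 1 : Set (AbelianModel Γ))
      (vertexIdeal Γ o k) := by
    induction k with
    | zero => rw [vertexIdeal_zero]; exact .bot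
    | succ k ih =>
      by_cases hk : ∃ v, o v = k
      · obtain ⟨v, rfl⟩ := hk
        exact (hstep v ih).2
      · push Not at hk
        rwa [vertexIdeal_succ_of_forall_ne hk]
  refine isKoszul_of_linearFiltration grading_zero F ?_
    (irrelevant_eq_vertexIdeal hn ▸ Or.inl ⟨N, rfl⟩)
  rintro _ (⟨k, rfl⟩ | ⟨v, rfl⟩)
  · exact hvertex k
  · exact (hstep v (hvertex _)).1

end AbelianModel

end SimpleGraph

theorem mainTheorem4 {V : Type*} [Finite V] [LinearOrder V] (Γ : SimpleGraph V)
    (hΓ : Γ.IsChordal) :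
    IsKoszul (SimpleGraph.AbelianModel.grading Γ) := by
  have := Fintype.ofFinite V
  obtain ⟨o, ho, hn, hpe⟩ := hΓ.exists_perfectElimination
  exact SimpleGraph.AbelianModel.isKoszul_of_isPerfectElimination ho hn hpe
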